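/- Let $\mathcal C$ be a finite ribbon category over a field $k$, that is, a $k$-linear abelian rigid monoidal category (with $k$-bilinear tensor product) with finite-dimensional morphism spaces, finitely many isomorphism classes of simple objects, a projective cover for each simple object and finite length of all objects, equipped with a braiding $c$ and a twist $\theta$ satisfying $\theta_{X\otimes Y}=c_{Y,X}\,c_{X,Y}\,(\theta_X\otimes\theta_Y)$ and $\theta_{X^\vee}=(\theta_X)^\vee$. Denote by $d_X\colon X^\vee\otimes X\to\mathbf 1$ and $b_X\colon\mathbf 1\to X\otimes X^\vee$ the evaluation and coevaluation of the right duality, and by $\gamma_{U,V}\colon U^\vee\otimes V^\vee\to(V\otimes U)^\vee$ the canonical isomorphism. The coend $K=\int^{X\in\mathcal C}X^\vee\otimes X$, with dinatural family $\iota_X\colon X^\vee\otimes X\to K$, exists, and it is a Hopf algebra in $\mathcal C$ (the handle Hopf algebra) with structural morphisms determined by $$m\circ(\iota_U\otimes\iota_V)=\iota_{V\otimes U}\circ(\gamma_{U,V}\otimes \mathrm{id}_{V\otimes U})\circ(\mathrm{id}_{U^\vee}\otimes c_{U,V^\vee\otimes V}),\qquad \eta=\iota_{\mathbf 1},$$ $$\Delta\circ\iota_U=(\iota_U\otimes\iota_U)\circ(\mathrm{id}_{U^\vee}\otimes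 b_U\otimes\mathrm{id}_U),\qquad \varepsilon\circ\iota_U=d_U,$$ $$S\circ\iota_U=(d_U\otimes\iota_{U^\vee})\circ(\mathrm{id}_{U^\vee}\otimes c_{U^{\vee\vee},U}\otimes\mathrm{id}_{U^\vee})\circ(b_{U^\vee}\otimes c_{U^\vee,U}).$$ For $Y\in\mathcal C$ let $\delta_Y=(\mathrm{id}_Y\otimes\iota_Y)\circ(b_Y\otimes\mathrm{id}_Y)\colon Y\to Y\otimes K$, let the partial monodromy $\mathcal Q_Y\colon K\otimes Y\to K\otimes Y$ be determined by $\mathcal Q_Y\circ(\iota_X\otimes\mathrm{id}_Y)=(\iota_X\otimes\mathrm{id}_Y)\circ(\mathrm{id}_{X^\vee}\otimes c_{Y,X}c_{X,Y})$ for all $X$, and put $\rho_Y=(\varepsilon\otimes\mathrm{id}_Y)\circ\mathcal Q_Y\colon K\otimes Y\to Y$. Then: (i) For every object $Y$ of $\mathcal C$, the morphism $\rho_Y$ endows $Y$ with the structure of a left $K$-module. (ii) For every $Y$, the left action $\rho_Y$ and the right coaction $\delta_Y$ make $Y$ a left-right Yetter–Drinfeld module over $K$ in $\mathcal C$, i.e.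 $\rho_Y$ is a left action, $\delta_Y$ is a right coaction, and $$(\rho_Y\otimes m)\circ(\mathrm{id}_K\otimes c_{K,Y}\otimes\mathrm{id}_K)\circ(\Delta\otimes\delta_Y)=(\mathrm{id}_Y\otimes m)\circ(\delta_Y\otimes\mathrm{id}_K)\circ c_{Y,K}^{-1}\circ(\mathrm{id}_K\otimes\rho_Y)\circ(\Delta\otimes\mathrm{id}_Y).$$ The assignment $Y\mapsto(Y,\rho_Y,\delta_Y)$, $f\mapsto f$, is a fully faithful embedding of $\mathcal C$ into the category of left-right Yetter–Drinfeld modules over $K$ internal to $\mathcal C$ (whose morphisms are the $K$-linear and $K$-colinear morphisms of $\mathcal C$). -/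

import Mathlib

open CategoryTheory Limits MonoidalCategory Opposite

universe w v u

/-! ### Finite ribbon categories -/

/-- `π : P ⟶ S` is a projective cover: `P` is projective and `π` is an essential epimorphism. -/
structure IsProjectiveCover {C : Type u} [Category.{v} C] {P S : C} (π : P ⟶ S) : Prop where
  projective : Projective P
  epi : Epi π
  essential : ∀ {Z : C} (g : Z ⟶ P), Epi (g ≫ π) → Epi g

/-- The finiteness conditions on a `k`-linear abelian rigid monoidal category that make it a
finite tensor category: finite-dimensional morphism spaces, finitely many simple objects up to
isomorphism, a projective cover for each simple object, and finite length of every object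
(i.e. both chain conditions on subobjects). -/
class IsFiniteTensorCategory (k : Type w) [Field k] (C : Type u) [Category.{v} C] [Abelian C]
    [Linear k C] [MonoidalCategory C] [MonoidalPreadditive C] [MonoidalLinear k C]
    [RigidCategory C] : Prop where
  finite_hom : ∀ X Y : C, Module.Finite k (X ⟶ Y)
  finite_simples : ∃ (n : ℕ) (S : Fin n → C), (∀ i, Simple (S i)) ∧
    ∀ X : C, Simple X → ∃ i, Nonempty (X ≅ S i)
  projective_cover : ∀ S : C, Simple S → ∃ (P : C) (π : P ⟶ S), IsProjectiveCover π
  finite_length : ∀ X : C, IsNoetherianObject X ∧ IsArtinianObject X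

/-- A ribbon structure on a braided rigid category: a natural family of automorphisms
(the twist), compatible with the tensor product through the double braiding and with
the (right) duality. -/
class RibbonCategory (C : Type u) [Category.{v} C] [MonoidalCategory C] [BraidedCategory C]
    [RigidCategory C] where
  twist : ∀ X : C, X ≅ X
  twist_naturality : ∀ {X Y : C} (f : X ⟶ Y), f ≫ (twist Y).hom = (twist X).hom ≫ f
  twist_tensor : ∀ X Y : C, (twist (X ⊗ Y)).hom =
    ((twist X).hom ⊗ₘ (twist Y).hom) ≫ (β_ X Y).hom ≫ (β_ Y X).hom
  twist_dual : ∀ X : C, (twist (Xᘁ)).hom = ((twist X).hom)ᘁ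

/-! ### Modules, comodules, Yetter–Drinfeld modules internal to a braided category -/

section YetterDrinfeld

variable {C : Type u} [Category.{v} C] [MonoidalCategory C]

/-- A right comodule structure on `Y` over a comonoid `K`. -/
class RightComodObj (K : C) [ComonObj K] (Y : C) where
  coact : Y ⟶ Y ⊗ K
  coact_counit : coact ≫ Y ◁ ComonObj.counit (X := K) = (ρ_ Y).inv
  coact_comul : coact ≫ Y ◁ ComonObj.comul (X := K) =
    coact ≫ coact ▷ K ≫ (α_ Y K K).hom

variable [BraidedCategory C]

/-- A left-right Yetter–Drinfeld structure on `Y` over a bimonoid `K` in a braided category: a left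
action `ρ` and a right coaction `δ` such that
`(ρ ⊗ m) ∘ (id ⊗ c_{K,Y} ⊗ id) ∘ (Δ ⊗ δ)
  = (id ⊗ m) ∘ (δ ⊗ id) ∘ c_{Y,K}⁻¹ ∘ (id ⊗ ρ) ∘ (Δ ⊗ id)` as morphisms `K ⊗ Y ⟶ Y ⊗ K`.
For vector spaces this is
`h₍₁₎ y₍₀₎ ⊗ h₍₂₎ y₍₁₎ = (h₍₂₎ y)₍₀₎ ⊗ (h₍₂₎ y)₍₁₎ h₍₁₎`. -/
class YetterDrinfeldObj (K : C) [BimonObj K] (Y : C) extends ModObj K Y, RightComodObj K Y where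
  compat :
    (ComonObj.comul (X := K) ⊗ₘ coact) ≫ (α_ K K (Y ⊗ K)).hom ≫
        K ◁ ((α_ K Y K).inv ≫ (β_ K Y).hom ▷ K ≫ (α_ Y K K).hom) ≫
        (α_ K Y (K ⊗ K)).inv ≫ ((smul : K ⊗ Y ⟶ Y) ⊗ₘ MonObj.mul (X := K)) =
      ComonObj.comul (X := K) ▷ Y ≫ (α_ K K Y).hom ≫ K ◁ (smul : K ⊗ Y ⟶ Y) ≫
        (β_ Y K).inv ≫ coact ▷ K ≫ (α_ Y K K).hom ≫ Y ◁ MonObj.mul (X := K)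

/-- Left-right Yetter–Drinfeld modules over `K` internal to the braided category `C`. -/
structure YetterDrinfeldModule (K : C) [BimonObj K] where
  X : C
  yd : YetterDrinfeldObj K X

namespace YetterDrinfeldModule

variable {K : C} [BimonObj K]

/-- The action of a Yetter–Drinfeld module. -/
def act (M : YetterDrinfeldModule K) : K ⊗ M.X ⟶ M.X := M.yd.smul

/-- The coaction of a Yetter–Drinfeld module. -/
def coact (M : YetterDrinfeldModule K) : M.X ⟶ M.X ⊗ K := M.yd.coact

/-- Morphisms of Yetter–Drinfeld modules: the morphisms that are `K`-linear and `K`-colinear. -/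
@[ext]
structure Hom (M N : YetterDrinfeldModule K) where
  hom : M.X ⟶ N.X
  act_hom : M.act ≫ hom = K ◁ hom ≫ N.act
  coact_hom : hom ≫ N.coact = M.coact ≫ hom ▷ K

instance : Category (YetterDrinfeldModule K) where
  Hom M N := Hom M N
  id M := ⟨𝟙 M.X, by simp, by simp⟩
  comp f g := ⟨f.hom ≫ g.hom,
    by rw [← Category.assoc, f.act_hom, Category.assoc, g.act_hom]; simp,
    by rw [Category.assoc, g.coact_hom, ← Category.assoc, f.coact_hom]; simp⟩
  id_comp f := Hom.ext (Category.id_comp f.hom)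
  comp_id f := Hom.ext (Category.comp_id f.hom)
  assoc f g h := Hom.ext (Category.assoc f.hom g.hom h.hom)

/-- The functor that forgets the action and the coaction. -/
def forget (K : C) [BimonObj K] : YetterDrinfeldModule K ⥤ C where
  obj M := M.X
  map f := Hom.hom f

end YetterDrinfeldModule

end YetterDrinfeld

/-! ### The handle Hopf algebra -/

noncomputable section

/-- The permutation `A ⊗ U ⊗ B ⊗ V ⟶ A ⊗ B ⊗ V ⊗ U` given by `id_A ⊗ c_{U, B ⊗ V}`. -/
def mulPerm {C : Type u} [Category.{v} C] [MonoidalCategory C] [BraidedCategory C]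
    (A U B V : C) : (A ⊗ U) ⊗ (B ⊗ V) ⟶ (A ⊗ B) ⊗ (V ⊗ U) :=
  (α_ A U (B ⊗ V)).hom ≫ A ◁ ((β_ U (B ⊗ V)).hom ≫ (α_ B V U).hom) ≫ (α_ A B (V ⊗ U)).inv

lemma mulPerm_naturality {C : Type u} [Category.{v} C] [MonoidalCategory C] [BraidedCategory C]
    {A A' U U' B B' V V' : C} (a : A ⟶ A') (u : U ⟶ U') (b : B ⟶ B')
    (w : V ⟶ V') : ((a ⊗ₘ u) ⊗ₘ (b ⊗ₘ w)) ≫ mulPerm A' U' B' V' =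
      mulPerm A U B V ≫ ((a ⊗ₘ b) ⊗ₘ (w ⊗ₘ u)) := by
  simp only [mulPerm, Category.assoc]
  rw [associator_naturality_assoc, ← id_tensorHom, ← id_tensorHom,
    tensorHom_comp_tensorHom_assoc, Category.comp_id,
    BraidedCategory.braiding_naturality_assoc, associator_naturality,
    ← associator_inv_naturality, tensorHom_comp_tensorHom_assoc, Category.id_comp,
    Category.assoc]

variable {C : Type u} [Category.{v} C] [MonoidalCategory C] [RigidCategory C]

variable (C) in
/-- The bifunctor `(X, Y) ↦ Xᘁ ⊗ Y`, contravariant in `X`. The right dual `Xᘁ` comes with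
`ε_ X Xᘁ : Xᘁ ⊗ X ⟶ 𝟙_ C` and `η_ X Xᘁ : 𝟙_ C ⟶ X ⊗ Xᘁ`. -/
def handleBifunctor : Cᵒᵖ ⥤ C ⥤ C where
  obj X := tensorLeft ((unop X)ᘁ)
  map f := { app := fun Y => (f.unop)ᘁ ▷ Y
             naturality := fun _ _ g => whisker_exchange _ g }
  map_id X := by ext; simp
  map_comp f g := by ext; simp [comp_rightAdjointMate]

variable (C) in
/-- A coend `∫^X Xᘁ ⊗ X` in `C`. -/
structure HandleCoend where
  cowedge : Cowedge (handleBifunctor C)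
  isColimit : IsColimit cowedge

/-- The evaluation morphism `d_X`. -/
abbrev rightEv (X : C) : Xᘁ ⊗ X ⟶ 𝟙_ C := ε_ X Xᘁ

/-- The coevaluation morphism `b_X`. -/
abbrev rightCoev (X : C) : 𝟙_ C ⟶ X ⊗ Xᘁ := η_ X Xᘁ


lemma rightDual_hom_ext {A X : C} {f g : A ⟶ Xᘁ}
    (h : f ▷ X ≫ rightEv X = g ▷ X ≫ rightEv X) : f = g := by
  have key : ∀ f : A ⟶ Xᘁ,
      tensorRightHomEquiv A X Xᘁ (𝟙_ C) (f ▷ X ≫ rightEv X) = f ≫ (λ_ (Xᘁ)).inv :=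
    fun f => tensorRightHomEquiv_whiskerRight_comp_evaluation f
  have h2 := congrArg (tensorRightHomEquiv A X Xᘁ (𝟙_ C)) h
  rw [key, key] at h2
  exact (cancel_mono _).1 h2

/-- The canonical isomorphism `γ_{U,V} : Uᘁ ⊗ Vᘁ ⟶ (V ⊗ U)ᘁ`. -/
def dualTensor (U V : C) : Uᘁ ⊗ Vᘁ ⟶ (V ⊗ U)ᘁ := (rightDualTensorIso V U).inv

/-- The nested evaluation of `Uᘁ ⊗ Vᘁ` against `V ⊗ U`. -/
def nestedEv (U V : C) : (Uᘁ ⊗ Vᘁ) ⊗ (V ⊗ U) ⟶ 𝟙_ C :=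
  @ExactPairing.evaluation C _ _ (V ⊗ U) (Uᘁ ⊗ Vᘁ) ExactPairing.tensor

lemma dualTensor_ev (U V : C) :
    dualTensor U V ▷ (V ⊗ U) ≫ rightEv (V ⊗ U) = nestedEv U V := by
  have := @rightAdjointMate_comp_evaluation C _ _ (V ⊗ U) (V ⊗ U)
    (RightRigidCategory.rightDual (V ⊗ U)) ⟨Uᘁ ⊗ Vᘁ⟩ (𝟙 (V ⊗ U))
  rw [whiskerLeft_id, Category.id_comp] at this
  exact this

lemma nestedEv_eq (U V : C) : nestedEv U V =
    (α_ (Uᘁ) (Vᘁ) (V ⊗ U)).hom ≫ Uᘁ ◁ ((α_ (Vᘁ) V U).inv ≫ rightEv V ▷ U ≫ (λ_ U).hom) ≫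
      rightEv U := by
  rw [nestedEv, ExactPairing.tensor_evaluation]
  monoidal

lemma dualTensor_naturality {U U' V V' : C} (f : U ⟶ U') (g : V ⟶ V') :
    (fᘁ ⊗ₘ gᘁ) ≫ dualTensor U V = dualTensor U' V' ≫ ((g ⊗ₘ f)ᘁ) := by
  apply rightDual_hom_ext
  rw [comp_whiskerRight, Category.assoc, dualTensor_ev, comp_whiskerRight, Category.assoc,
    rightAdjointMate_comp_evaluation, ← whisker_exchange_assoc, dualTensor_ev,
    nestedEv_eq, nestedEv_eq]
  have h1 := rightAdjointMate_comp_evaluation g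
  have h2 := rightAdjointMate_comp_evaluation f
  have e1 : (fᘁ ⊗ₘ gᘁ) ▷ (V ⊗ U) ≫ (α_ (Uᘁ) (Vᘁ) (V ⊗ U)).hom ≫
      Uᘁ ◁ ((α_ (Vᘁ) V U).inv ≫ rightEv V ▷ U ≫ (λ_ U).hom) ≫ rightEv U =
      (α_ (U'ᘁ) (V'ᘁ) (V ⊗ U)).hom ≫
      U'ᘁ ◁ ((α_ (V'ᘁ) V U).inv ≫ (gᘁ ▷ V ≫ rightEv V) ▷ U ≫ (λ_ U).hom) ≫
        fᘁ ▷ U ≫ rightEv U := by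
    rw [whisker_exchange_assoc, MonoidalCategory.tensorHom_def]
    monoidal
  have e2 : (U'ᘁ ⊗ V'ᘁ) ◁ (g ⊗ₘ f) ≫ (α_ (U'ᘁ) (V'ᘁ) (V' ⊗ U')).hom ≫
      U'ᘁ ◁ ((α_ (V'ᘁ) V' U').inv ≫ rightEv V' ▷ U' ≫ (λ_ U').hom) ≫ rightEv U' =
      (α_ (U'ᘁ) (V'ᘁ) (V ⊗ U)).hom ≫
      U'ᘁ ◁ ((α_ (V'ᘁ) V U).inv ≫ (V'ᘁ ◁ g ≫ rightEv V') ▷ U ≫ (λ_ U).hom) ≫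
        U'ᘁ ◁ f ≫ rightEv U' := by
    have : (V'ᘁ ◁ g ≫ rightEv V') ▷ U ≫ (λ_ U).hom ≫ f =
        (V'ᘁ ◁ g) ▷ U ≫ (V'ᘁ ⊗ V') ◁ f ≫ rightEv V' ▷ U' ≫ (λ_ U').hom := by
      rw [whisker_exchange_assoc]; simp
    simp only [← whiskerLeft_comp_assoc, Category.assoc, this]
    simp [MonoidalCategory.tensorHom_def]
  rw [e1, e2, h1, h2]

namespace HandleCoend

variable (K : HandleCoend C)

/-- The object underlying the coend. -/
def obj : C := K.cowedge.pt

/-- The dinatural family `ι_X : Xᘁ ⊗ X ⟶ K`. -/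
def ι (X : C) : Xᘁ ⊗ X ⟶ K.obj := K.cowedge.π X

lemma dinat {X Y : C} (f : X ⟶ Y) : fᘁ ▷ X ≫ K.ι X = Yᘁ ◁ f ≫ K.ι Y :=
  K.cowedge.condition f

lemma hom_ext {Z : C} {f g : K.obj ⟶ Z} (h : ∀ X, K.ι X ≫ f = K.ι X ≫ g) : f = g :=
  Cowedge.IsColimit.hom_ext K.isColimit h

/-- The morphism out of the coend that is induced by a dinatural family. -/
def desc {Z : C} (f : ∀ X : C, Xᘁ ⊗ X ⟶ Z)
    (hf : ∀ ⦃X Y : C⦄ (g : X ⟶ Y), gᘁ ▷ X ≫ f X = Yᘁ ◁ g ≫ f Y) : K.obj ⟶ Z :=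
  Cowedge.IsColimit.desc K.isColimit f hf

lemma ι_desc {Z : C} (f : ∀ X : C, Xᘁ ⊗ X ⟶ Z)
    (hf : ∀ ⦃X Y : C⦄ (g : X ⟶ Y), gᘁ ▷ X ≫ f X = Yᘁ ◁ g ≫ f Y) (X : C) :
    K.ι X ≫ K.desc f hf = f X :=
  Cowedge.IsColimit.π_desc K.isColimit f hf X

/-- The morphism `K ⊗ Y ⟶ Z` that is induced by a dinatural family
`(Xᘁ ⊗ X) ⊗ Y ⟶ Z` (`- ⊗ Y` is a left adjoint, hence preserves the coend). -/
def descRight {Y Z : C} (f : ∀ X : C, (Xᘁ ⊗ X) ⊗ Y ⟶ Z)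
    (hf : ∀ ⦃X X' : C⦄ (g : X ⟶ X'),
      (gᘁ ▷ X) ▷ Y ≫ f X = (X'ᘁ ◁ g) ▷ Y ≫ f X') : K.obj ⊗ Y ⟶ Z :=
  (tensorRightHomEquiv K.obj Y Yᘁ Z).symm
    (K.desc (fun X => tensorRightHomEquiv (Xᘁ ⊗ X) Y Yᘁ Z (f X)) (fun X X' g => by
      apply (tensorRightHomEquiv _ Y Yᘁ Z).symm.injective
      rw [tensorRightHomEquiv_symm_naturality, tensorRightHomEquiv_symm_naturality,
        Equiv.symm_apply_apply, Equiv.symm_apply_apply, hf]))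

lemma ι_descRight {Y Z : C} (f : ∀ X : C, (Xᘁ ⊗ X) ⊗ Y ⟶ Z)
    (hf : ∀ ⦃X X' : C⦄ (g : X ⟶ X'),
      (gᘁ ▷ X) ▷ Y ≫ f X = (X'ᘁ ◁ g) ▷ Y ≫ f X') (X : C) :
    K.ι X ▷ Y ≫ K.descRight f hf = f X := by
  rw [descRight, ← tensorRightHomEquiv_symm_naturality, ι_desc, Equiv.symm_apply_apply]

lemma hom_ext_right {Y Z : C} {f g : K.obj ⊗ Y ⟶ Z}
    (h : ∀ X, K.ι X ▷ Y ≫ f = K.ι X ▷ Y ≫ g) : f = g := by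
  apply (tensorRightHomEquiv K.obj Y Yᘁ Z).injective
  apply K.hom_ext
  intro X
  apply (tensorRightHomEquiv _ Y Yᘁ Z).symm.injective
  rw [tensorRightHomEquiv_symm_naturality, tensorRightHomEquiv_symm_naturality,
    Equiv.symm_apply_apply, Equiv.symm_apply_apply, h]

/-- The morphism `Y ⊗ K ⟶ Z` that is induced by a dinatural family
`Y ⊗ (Xᘁ ⊗ X) ⟶ Z` (`Y ⊗ -` is a left adjoint, hence preserves the coend). -/
def descLeft {Y Z : C} (f : ∀ X : C, Y ⊗ (Xᘁ ⊗ X) ⟶ Z)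
    (hf : ∀ ⦃X X' : C⦄ (g : X ⟶ X'),
      Y ◁ (gᘁ ▷ X) ≫ f X = Y ◁ (X'ᘁ ◁ g) ≫ f X') : Y ⊗ K.obj ⟶ Z :=
  (tensorLeftHomEquiv K.obj (HasLeftDual.leftDual Y) Y Z).symm
    (K.desc (fun X => tensorLeftHomEquiv (Xᘁ ⊗ X) (HasLeftDual.leftDual Y) Y Z (f X))
      (fun X X' g => by
        apply (tensorLeftHomEquiv _ (HasLeftDual.leftDual Y) Y Z).symm.injective
        rw [tensorLeftHomEquiv_symm_naturality, tensorLeftHomEquiv_symm_naturality,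
          Equiv.symm_apply_apply, Equiv.symm_apply_apply, hf]))

lemma ι_descLeft {Y Z : C} (f : ∀ X : C, Y ⊗ (Xᘁ ⊗ X) ⟶ Z)
    (hf : ∀ ⦃X X' : C⦄ (g : X ⟶ X'),
      Y ◁ (gᘁ ▷ X) ≫ f X = Y ◁ (X'ᘁ ◁ g) ≫ f X') (X : C) :
    Y ◁ K.ι X ≫ K.descLeft f hf = f X := by
  rw [descLeft, ← tensorLeftHomEquiv_symm_naturality, ι_desc, Equiv.symm_apply_apply]

lemma hom_ext_left {Y Z : C} {f g : Y ⊗ K.obj ⟶ Z}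
    (h : ∀ X, Y ◁ K.ι X ≫ f = Y ◁ K.ι X ≫ g) : f = g := by
  apply (tensorLeftHomEquiv K.obj (HasLeftDual.leftDual Y) Y Z).injective
  apply K.hom_ext
  intro X
  apply (tensorLeftHomEquiv _ (HasLeftDual.leftDual Y) Y Z).symm.injective
  rw [tensorLeftHomEquiv_symm_naturality, tensorLeftHomEquiv_symm_naturality,
    Equiv.symm_apply_apply, Equiv.symm_apply_apply, h]

/-- The unit `η = ι_𝟙` (up to the canonical isomorphism `𝟙 ≅ 𝟙ᘁ ⊗ 𝟙`). -/
def one : 𝟙_ C ⟶ K.obj :=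
  rightCoev (𝟙_ C) ≫ (λ_ _).hom ≫ (ρ_ _).inv ≫ K.ι (𝟙_ C)

/-- The morphism `(id ⊗ b_X ⊗ id)` followed by `ι_X ⊗ ι_X`. -/
def comulFamily (X : C) : Xᘁ ⊗ X ⟶ K.obj ⊗ K.obj :=
  Xᘁ ◁ ((λ_ X).inv ≫ rightCoev X ▷ X ≫ (α_ X (Xᘁ) X).hom) ≫
    (α_ (Xᘁ) X (Xᘁ ⊗ X)).inv ≫ (K.ι X ⊗ₘ K.ι X)

lemma comulFamily_dinat ⦃X Y : C⦄ (g : X ⟶ Y) :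
    gᘁ ▷ X ≫ K.comulFamily X = Yᘁ ◁ g ≫ K.comulFamily Y := by
  have h := coevaluation_comp_rightAdjointMate g
  calc
    _ = (Yᘁ : C) ◁ ((λ_ X).inv ≫ rightCoev X ▷ X ≫ (α_ X (Xᘁ) X).hom) ≫
        (α_ (Yᘁ) X (Xᘁ ⊗ X)).inv ≫ (gᘁ ▷ X ≫ K.ι X) ▷ (Xᘁ ⊗ X) ≫ K.obj ◁ K.ι X := by
      rw [comulFamily, MonoidalCategory.tensorHom_def, ← whisker_exchange_assoc]
      simp
    _ = (Yᘁ : C) ◁ ((λ_ X).inv ≫ (rightCoev X ≫ g ▷ (Xᘁ : C)) ▷ X ≫ (α_ Y (Xᘁ) X).hom) ≫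
        (α_ (Yᘁ) Y (Xᘁ ⊗ X)).inv ≫ K.ι Y ▷ (Xᘁ ⊗ X) ≫ K.obj ◁ K.ι X := by
      rw [K.dinat]; simp
    _ = (Yᘁ : C) ◁ ((λ_ X).inv ≫ rightCoev Y ▷ X ≫ (α_ Y (Yᘁ) X).hom) ≫
        (α_ (Yᘁ) Y (Yᘁ ⊗ X)).inv ≫ (Yᘁ ⊗ Y) ◁ (gᘁ ▷ X) ≫
          K.ι Y ▷ (Xᘁ ⊗ X) ≫ K.obj ◁ K.ι X := by
      rw [← h]; simp
    _ = (Yᘁ : C) ◁ ((λ_ X).inv ≫ rightCoev Y ▷ X ≫ (α_ Y (Yᘁ) X).hom) ≫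
        (α_ (Yᘁ) Y (Yᘁ ⊗ X)).inv ≫ (Yᘁ ⊗ Y) ◁ ((Yᘁ : C) ◁ g) ≫
          K.ι Y ▷ (Yᘁ ⊗ Y) ≫ K.obj ◁ K.ι Y := by
      rw [whisker_exchange_assoc, whisker_exchange_assoc, ← MonoidalCategory.whiskerLeft_comp,
        ← MonoidalCategory.whiskerLeft_comp, K.dinat]
    _ = _ := by
      rw [comulFamily, MonoidalCategory.tensorHom_def]
      have : (λ_ X).inv ≫ rightCoev Y ▷ X ≫ (α_ Y (Yᘁ) X).hom ≫ Y ◁ (Yᘁ : C) ◁ g =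
          g ≫ (λ_ Y).inv ≫ rightCoev Y ▷ Y ≫ (α_ Y (Yᘁ) Y).hom := by
        rw [leftUnitor_inv_naturality_assoc, whisker_exchange_assoc]; simp
      rw [← MonoidalCategory.whiskerLeft_comp_assoc, ← this]
      simp

/-- The coproduct: `Δ ∘ ι_X = (ι_X ⊗ ι_X) ∘ (id ⊗ b_X ⊗ id)`. -/
def comul : K.obj ⟶ K.obj ⊗ K.obj := K.desc K.comulFamily K.comulFamily_dinat

/-- The counit: `ε ∘ ι_X = d_X`. -/
def counit : K.obj ⟶ 𝟙_ C :=
  K.desc (fun X => rightEv X) (fun _ _ g => rightAdjointMate_comp_evaluation g)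

/-- The coaction `δ_Y = (id_Y ⊗ ι_Y) ∘ (b_Y ⊗ id_Y)`. -/
def coaction (Y : C) : Y ⟶ Y ⊗ K.obj :=
  (λ_ Y).inv ≫ rightCoev Y ▷ Y ≫ (α_ Y (Yᘁ) Y).hom ≫ Y ◁ K.ι Y

variable [BraidedCategory C]

/-- The morphism `ι_{V ⊗ U} ∘ (γ_{U,V} ⊗ id) ∘ (id ⊗ c_{U, Vᘁ ⊗ V})`. -/
def mulFamily (U V : C) : (Uᘁ ⊗ U) ⊗ (Vᘁ ⊗ V) ⟶ K.obj :=
  mulPerm (Uᘁ) U (Vᘁ) V ≫ dualTensor U V ▷ (V ⊗ U) ≫ K.ι (V ⊗ U)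

lemma mulFamily_dinat {U U' V V' : C} (f : U ⟶ U') (g : V ⟶ V') :
    (fᘁ ▷ U ⊗ₘ gᘁ ▷ V) ≫ K.mulFamily U V =
      (U'ᘁ ◁ f ⊗ₘ V'ᘁ ◁ g) ≫ K.mulFamily U' V' := by
  simp only [mulFamily, ← tensorHom_id, ← id_tensorHom]
  rw [← Category.assoc, mulPerm_naturality, ← Category.assoc _ _ (_ ≫ _), mulPerm_naturality]
  simp only [Category.assoc, id_tensorHom_id]
  rw [tensorHom_comp_tensorHom_assoc, tensorHom_comp_tensorHom_assoc, dualTensor_naturality]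
  congr 1
  have := K.dinat (g ⊗ₘ f)
  simp only [Category.id_comp, Category.comp_id]
  rw [MonoidalCategory.tensorHom_def, MonoidalCategory.tensorHom_def (dualTensor U' V'),
    Category.assoc, Category.assoc, ← this]
  simp

lemma mulFamily_dinat_left (U : C) ⦃V V' : C⦄ (g : V ⟶ V') :
    (Uᘁ ⊗ U) ◁ (gᘁ ▷ V) ≫ K.mulFamily U V =
      (Uᘁ ⊗ U) ◁ (V'ᘁ ◁ g) ≫ K.mulFamily U V' := by
  simpa using K.mulFamily_dinat (𝟙 U) g

/-- The product on the first-slot summand `Uᘁ ⊗ U`. -/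
def mulLeft (U : C) : (Uᘁ ⊗ U) ⊗ K.obj ⟶ K.obj :=
  K.descLeft (K.mulFamily U) (K.mulFamily_dinat_left U)

lemma mulLeft_dinat ⦃U U' : C⦄ (f : U ⟶ U') :
    (fᘁ ▷ U) ▷ K.obj ≫ K.mulLeft U = (U'ᘁ ◁ f) ▷ K.obj ≫ K.mulLeft U' := by
  apply K.hom_ext_left
  intro V
  rw [whisker_exchange_assoc, whisker_exchange_assoc, mulLeft, mulLeft, ι_descLeft,
    ι_descLeft]
  simpa using K.mulFamily_dinat f (𝟙 V)

/-- The product: `m ∘ (ι_U ⊗ ι_V) = ι_{V ⊗ U} ∘ (γ_{U,V} ⊗ id) ∘ (id ⊗ c_{U, Vᘁ ⊗ V})`. -/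
def mul : K.obj ⊗ K.obj ⟶ K.obj := K.descRight K.mulLeft K.mulLeft_dinat

lemma ι_mul (U V : C) : (K.ι U ⊗ₘ K.ι V) ≫ K.mul = K.mulFamily U V := by
  rw [tensorHom_def', Category.assoc, mul, ι_descRight, mulLeft, ι_descLeft]

/-- The morphism `(d_X ⊗ id) ∘ (id ⊗ c_{Xᘁᘁ, X}) ∘ (b_{Xᘁ} ⊗ id) : X ⟶ Xᘁᘁ`. -/
def doubleDual (X : C) : X ⟶ (Xᘁ)ᘁ :=
  (λ_ X).inv ≫ rightCoev (Xᘁ) ▷ X ≫ (α_ (Xᘁ) ((Xᘁ)ᘁ) X).hom ≫ Xᘁ ◁ (β_ ((Xᘁ)ᘁ) X).hom ≫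
    (α_ (Xᘁ) X ((Xᘁ)ᘁ)).inv ≫ rightEv X ▷ ((Xᘁ)ᘁ) ≫ (λ_ _).hom

lemma doubleDual_naturality {X Y : C} (g : X ⟶ Y) :
    g ≫ doubleDual Y = doubleDual X ≫ (gᘁ)ᘁ := by
  have h1 := coevaluation_comp_rightAdjointMate (gᘁ)
  have h2 := rightAdjointMate_comp_evaluation g
  calc
    _ = (λ_ X).inv ≫ rightCoev (Yᘁ) ▷ X ≫ (α_ _ _ _).hom ≫
        Yᘁ ◁ ((Yᘁ)ᘁ ◁ g ≫ (β_ ((Yᘁ)ᘁ) Y).hom) ≫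
        (α_ _ _ _).inv ≫ rightEv Y ▷ _ ≫ (λ_ _).hom := by
      simp only [doubleDual, leftUnitor_inv_naturality_assoc, whiskerLeft_comp, Category.assoc]
      rw [whisker_exchange_assoc]; simp
    _ = (λ_ X).inv ≫ rightCoev (Yᘁ) ▷ X ≫ (α_ _ _ _).hom ≫
        Yᘁ ◁ (β_ ((Yᘁ)ᘁ) X).hom ≫
        (α_ _ _ _).inv ≫ (Yᘁ ◁ g ≫ rightEv Y) ▷ _ ≫ (λ_ _).hom := by
      rw [BraidedCategory.braiding_naturality_right]; simp
    _ = (λ_ X).inv ≫ (rightCoev (Yᘁ) ≫ gᘁ ▷ _) ▷ X ≫ (α_ _ _ _).hom ≫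
        Xᘁ ◁ (β_ ((Yᘁ)ᘁ) X).hom ≫
        (α_ _ _ _).inv ≫ rightEv X ▷ _ ≫ (λ_ _).hom := by
      rw [← h2]
      have := whisker_exchange_assoc (gᘁ) ((β_ ((Yᘁ)ᘁ) X).hom) ((α_ (Xᘁ) X ((Yᘁ)ᘁ)).inv ≫
        rightEv X ▷ _ ≫ (λ_ _).hom)
      simp only [comp_whiskerRight, Category.assoc, associator_naturality_left_assoc]
      rw [← this]
      simp
    _ = (λ_ X).inv ≫ rightCoev (Xᘁ) ▷ X ≫ (α_ _ _ _).hom ≫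
        Xᘁ ◁ ((gᘁ)ᘁ ▷ X ≫ (β_ ((Yᘁ)ᘁ) X).hom) ≫
        (α_ _ _ _).inv ≫ rightEv X ▷ _ ≫ (λ_ _).hom := by
      rw [← h1]
      simp only [comp_whiskerRight, Category.assoc, MonoidalCategory.whiskerLeft_comp,
        associator_naturality_middle_assoc]
    _ = _ := by
      rw [BraidedCategory.braiding_naturality_left]
      simp only [doubleDual, Category.assoc, ← leftUnitor_naturality, whiskerLeft_comp]
      rw [← whisker_exchange_assoc]; simp

/-- The morphism
`(d_X ⊗ ι_{Xᘁ}) ∘ (id ⊗ c_{Xᘁᘁ, X} ⊗ id) ∘ (b_{Xᘁ} ⊗ c_{Xᘁ, X})`. -/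
def antipodeFamily (X : C) : Xᘁ ⊗ X ⟶ K.obj :=
  (β_ (Xᘁ) X).hom ≫ doubleDual X ▷ (Xᘁ) ≫ K.ι (Xᘁ)

lemma antipodeFamily_dinat ⦃X Y : C⦄ (g : X ⟶ Y) :
    gᘁ ▷ X ≫ K.antipodeFamily X = Yᘁ ◁ g ≫ K.antipodeFamily Y := by
  rw [antipodeFamily, antipodeFamily, BraidedCategory.braiding_naturality_left_assoc,
    BraidedCategory.braiding_naturality_right_assoc, whisker_exchange_assoc, ← K.dinat,
    ← comp_whiskerRight_assoc, ← comp_whiskerRight_assoc, doubleDual_naturality]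

/-- The antipode:
`S ∘ ι_X = (d_X ⊗ ι_{Xᘁ}) ∘ (id ⊗ c_{Xᘁᘁ, X} ⊗ id) ∘ (b_{Xᘁ} ⊗ c_{Xᘁ, X})`. -/
def antipode : K.obj ⟶ K.obj := K.desc K.antipodeFamily K.antipodeFamily_dinat

/-- The morphism `(ι_X ⊗ id_Y) ∘ (id ⊗ c_{Y,X} c_{X,Y})`. -/
def monodromyFamily (Y X : C) : (Xᘁ ⊗ X) ⊗ Y ⟶ K.obj ⊗ Y :=
  (α_ (Xᘁ) X Y).hom ≫ Xᘁ ◁ ((β_ X Y).hom ≫ (β_ Y X).hom) ≫ (α_ (Xᘁ) X Y).inv ≫ K.ι X ▷ Y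

lemma monodromyFamily_dinat (Y : C) ⦃X X' : C⦄ (g : X ⟶ X') :
    (gᘁ ▷ X) ▷ Y ≫ K.monodromyFamily Y X = (X'ᘁ ◁ g) ▷ Y ≫ K.monodromyFamily Y X' := by
  have h : g ▷ Y ≫ (β_ X' Y).hom ≫ (β_ Y X').hom =
      ((β_ X Y).hom ≫ (β_ Y X).hom) ≫ g ▷ Y := by simp
  have e1 : (gᘁ ▷ X) ▷ Y ≫ K.monodromyFamily Y X =
      (α_ _ _ _).hom ≫ (X'ᘁ : C) ◁ ((β_ X Y).hom ≫ (β_ Y X).hom) ≫ (α_ _ _ _).inv ≫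
        (gᘁ ▷ X ≫ K.ι X) ▷ Y := by
    rw [monodromyFamily, associator_naturality_left_assoc, ← whisker_exchange_assoc]; simp
  have e2 : (X'ᘁ ◁ g) ▷ Y ≫ K.monodromyFamily Y X' =
      (α_ _ _ _).hom ≫ (X'ᘁ : C) ◁ ((β_ X Y).hom ≫ (β_ Y X).hom) ≫ (α_ _ _ _).inv ≫
        ((X'ᘁ : C) ◁ g ≫ K.ι X') ▷ Y := by
    rw [monodromyFamily, associator_naturality_middle_assoc, ← whiskerLeft_comp_assoc, h]; simp
  rw [e1, e2, K.dinat]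

/-- The partial monodromy `Q_Y` between `K` and `Y`:
`Q_Y ∘ (ι_X ⊗ id_Y) = (ι_X ⊗ id_Y) ∘ (id ⊗ c_{Y,X} c_{X,Y})`. -/
def partialMonodromy (Y : C) : K.obj ⊗ Y ⟶ K.obj ⊗ Y :=
  K.descRight (K.monodromyFamily Y) (K.monodromyFamily_dinat Y)

/-- The partial monodromy action `ρ_Y = (ε ⊗ id_Y) ∘ Q_Y`. -/
def action (Y : C) : K.obj ⊗ Y ⟶ Y :=
  K.partialMonodromy Y ≫ K.counit ▷ Y ≫ (λ_ Y).hom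

end HandleCoend

end

/-! ### Existence of the coend -/

section Existence

attribute [local instance] Abelian.hasFiniteBiproducts

/-! Existence. The sum `P` of projective covers of the simple objects is a projective generator, and
a morphism out of `X` is the same as an `End P`-linear map on `Hom(P, X)`
(`IsFiniteGenerator.exists_hom`). So a dinatural family is determined by its component at `P`, and
the coend is the quotient of `Pᘁ ⊗ P` by the dinaturality relations for a finite basis of `End P`.

Hopf and Yetter–Drinfeld structure. By duality, the dinatural family `ι` is the same datum as the
natural family of coactions `δ_X : X ⟶ X ⊗ K`, and a morphism `f` out of `K` is determined by the
natural family `(id_X ⊗ f) ∘ δ_X` (`hom_ext_coaction`, with versions for `K ⊗ Y` and for two copies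
of `K`). Under this dictionary the coproduct is the iterated coaction, the counit is the identity,
the unit is `δ` at the tensor unit, the product is `δ` at a tensor product (`coaction_tensor`), the
antipode is built from `δ` at a dual, and the action on `Y` is the double braiding with `Y`
(`coaction_action`).

Each axiom thus becomes naturality of `δ` along a structural morphism, or a braid identity. Unitors
and associators give the algebra axioms, evaluation and coevaluation the antipode axioms, and the
hexagons the module axiom. Naturality along the double braiding `X ⊗ Y ⟶ X ⊗ Y` is exactly the
Yetter–Drinfeld condition. Since every morphism of `C` commutes with `δ` and with double braidings,
the embedding is full. -/

lemma rightAdjointMate_eq_of_evaluation {C : Type u} [Category.{v} C] [MonoidalCategory C]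
    [RigidCategory C] {X Y : C} (f : X ⟶ Y) {g : Yᘁ ⟶ Xᘁ}
    (h : g ▷ X ≫ rightEv X = Yᘁ ◁ f ≫ rightEv Y) : g = fᘁ :=
  rightDual_hom_ext (h.trans (rightAdjointMate_comp_evaluation f).symm)

section Linear

variable {k : Type w} [Field k] {C : Type u} [Category.{v} C] [Preadditive C]
  [Linear k C] [MonoidalCategory C] [MonoidalPreadditive C] [MonoidalLinear k C] [RigidCategory C]

lemma rightAdjointMate_add {X Y : C} (f g : X ⟶ Y) : (f + g)ᘁ = fᘁ + gᘁ := by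
  symm
  apply rightAdjointMate_eq_of_evaluation
  simp [MonoidalPreadditive.add_whiskerRight, MonoidalPreadditive.whiskerLeft_add,
    rightAdjointMate_comp_evaluation]

lemma rightAdjointMate_smul (a : k) {X Y : C} (f : X ⟶ Y) : (a • f)ᘁ = a • fᘁ := by
  symm
  apply rightAdjointMate_eq_of_evaluation
  simp [rightAdjointMate_comp_evaluation]

end Linear

/-- An object `P` is a finite generator if every object is a quotient of a finite power of `P`. -/
def IsFiniteGenerator {C : Type u} [Category.{v} C] [Abelian C] (P : C) : Prop :=
  ∀ X : C, ∃ (n : ℕ) (p : (⨁ fun _ : Fin n => P) ⟶ X), Epi p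

/-- The generator is the sum of the projective covers. If the joint image of all maps from it to `X`
were proper, the cokernel would contain a simple subobject; the cover of that simple would lift to
`X` by projectivity and yet die in the cokernel. -/
lemma exists_projective_finiteGenerator (k : Type w) [Field k] (C : Type u) [Category.{v} C]
    [Abelian C] [Linear k C] [MonoidalCategory C] [MonoidalPreadditive C] [MonoidalLinear k C]
    [RigidCategory C] [IsFiniteTensorCategory k C] :
    ∃ P : C, Projective P ∧ IsFiniteGenerator P := by
  obtain ⟨n, S, hS, hS'⟩ := IsFiniteTensorCategory.finite_simples (k := k) (C := C)
  choose P π hπ using fun i => IsFiniteTensorCategory.projective_cover (k := k) (S i) (hS i)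
  have := fun i => (hπ i).projective
  have hproj : Projective (⨁ P) :=
    ⟨fun f e _ => ⟨biproduct.desc fun i => Projective.factorThru (biproduct.ι P i ≫ f) e, by
      apply biproduct.hom_ext'
      simp⟩⟩
  refine ⟨⨁ P, hproj, fun X => ?_⟩
  have := IsFiniteTensorCategory.finite_hom (k := k) (⨁ P) X
  let b := Module.finBasis k ((⨁ P) ⟶ X)
  -- One copy of the generator for each element of a basis of the Hom space, so that every map from
  -- the generator to `X` factors through `p`.
  refine ⟨_, biproduct.desc b, ?_⟩
  set p := biproduct.desc b
  have hp : ∀ h : (⨁ P) ⟶ X, h ≫ cokernel.π p = 0 := by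
    intro h
    rw [← b.sum_repr h, Preadditive.sum_comp]
    refine Finset.sum_eq_zero fun i _ => ?_
    have : b i = biproduct.ι (fun _ => ⨁ P) i ≫ p := by simp [p]
    rw [Linear.smul_comp, this, Category.assoc, cokernel.condition, comp_zero, smul_zero]
  have hz : IsZero (cokernel p) := by
    by_contra hz
    have := (IsFiniteTensorCategory.finite_length (k := k) (cokernel p)).2
    obtain ⟨T, hT⟩ := exists_simple_subobject hz
    obtain ⟨i, ⟨e⟩⟩ := hS' _ hT
    have := (hπ i).epi
    let q : (⨁ P) ⟶ cokernel p := biproduct.π P i ≫ π i ≫ e.inv ≫ T.arrow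
    have h0 : q = 0 := by
      have := hp (Projective.factorThru q (cokernel.π p))
      rwa [Projective.factorThru_comp] at this
    have h1 : T.arrow = 0 := by
      rw [← cancel_epi e.inv, ← cancel_epi (π i), ← cancel_epi (biproduct.π P i)]
      simpa [q] using h0
    exact Simple.not_isZero (T : C) (IsZero.of_mono_eq_zero _ h1)
  exact Preadditive.epi_of_cokernel_zero (hz.eq_of_tgt _ _)

namespace IsFiniteGenerator

variable {C : Type u} [Category.{v} C] [Abelian C] {P : C}

lemma hom_ext (hP : IsFiniteGenerator P) {X T : C} {f g : X ⟶ T}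
    (h : ∀ a : P ⟶ X, a ≫ f = a ≫ g) : f = g := by
  obtain ⟨n, p, _⟩ := hP X
  rw [← cancel_epi p]
  apply biproduct.hom_ext'
  intro i
  simpa using h (biproduct.ι (fun _ => P) i ≫ p)

/-- Fullness of `Hom(P, -)` with respect to `End P`-linear maps: prescribe the map on a cover of `X`
by copies of `P` and descend along it. -/
lemma exists_hom [Projective P] (hP : IsFiniteGenerator P) {X T : C} (φ : (P ⟶ X) →+ (P ⟶ T))
    (hφ : ∀ (e : P ⟶ P) (h : P ⟶ X), φ (e ≫ h) = e ≫ φ h) :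
    ∃ u : X ⟶ T, ∀ h : P ⟶ X, h ≫ u = φ h := by
  obtain ⟨n, p, _⟩ := hP X
  let g : (⨁ fun _ : Fin n => P) ⟶ T := biproduct.desc fun i => φ (biproduct.ι (fun _ => P) i ≫ p)
  have hg : ∀ c : P ⟶ ⨁ fun _ : Fin n => P, c ≫ g = φ (c ≫ p) := by
    intro c
    have hc : c ≫ p = ∑ i, (c ≫ biproduct.π (fun _ => P) i) ≫ biproduct.ι (fun _ => P) i ≫ p := by
      simp only [Category.assoc, ← Preadditive.comp_sum]
      simp only [← Category.assoc (biproduct.π _ _), ← Preadditive.sum_comp, biproduct.total,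
        Category.id_comp]
    rw [hc, map_sum]
    simp only [hφ]
    simp only [g, biproduct.desc_eq, Preadditive.comp_sum, Category.assoc]
  -- Tested on maps from `P`: a map into the kernel is sent by `g` to `φ 0`.
  have hk : kernel.ι p ≫ g = 0 := by
    apply hP.hom_ext
    intro a
    rw [← Category.assoc, hg]
    simp
  refine ⟨Abelian.epiDesc p g hk, fun h => ?_⟩
  rw [← Projective.factorThru_comp h p, Category.assoc, Abelian.comp_epiDesc, hg]

end IsFiniteGenerator

namespace HandleCoend

variable {C : Type u} [Category.{v} C] [Abelian C] [MonoidalCategory C] [RigidCategory C] {P : C}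

lemma tensorLeft_hom_ext (hP : IsFiniteGenerator P) {Y X T : C} {f g : Y ⊗ X ⟶ T}
    (h : ∀ a : P ⟶ X, Y ◁ a ≫ f = Y ◁ a ≫ g) : f = g := by
  apply (tensorLeftHomEquiv X (HasLeftDual.leftDual Y) Y T).injective
  apply hP.hom_ext
  intro a
  apply (tensorLeftHomEquiv _ (HasLeftDual.leftDual Y) Y T).symm.injective
  rw [tensorLeftHomEquiv_symm_naturality, tensorLeftHomEquiv_symm_naturality,
    Equiv.symm_apply_apply, Equiv.symm_apply_apply, h]

variable [MonoidalPreadditive C]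

/-- `Y ⊗ -` is left adjoint to tensoring with the left dual of `Y`, so the statement without `Y` can
be transported. -/
lemma tensorLeft_exists_hom [Projective P] (hP : IsFiniteGenerator P) {Y X T : C}
    (φ : (P ⟶ X) →+ (Y ⊗ P ⟶ T))
    (hφ : ∀ (e : P ⟶ P) (h : P ⟶ X), φ (e ≫ h) = Y ◁ e ≫ φ h) :
    ∃ u : Y ⊗ X ⟶ T, ∀ h : P ⟶ X, Y ◁ h ≫ u = φ h := by
  let E := fun A => tensorLeftHomEquiv A (HasLeftDual.leftDual Y) Y T
  have hE : ∀ a b, E P (a + b) = E P a + E P b := by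
    intro a b
    simp [E, tensorLeftHomEquiv, MonoidalPreadditive.whiskerLeft_add]
  have hn : ∀ {A B : C} (a : A ⟶ B) (f : Y ⊗ B ⟶ T), E A (Y ◁ a ≫ f) = a ≫ E B f := by
    intro A B a f
    rw [← Equiv.eq_symm_apply, tensorLeftHomEquiv_symm_naturality, Equiv.symm_apply_apply]
  obtain ⟨u, hu⟩ := hP.exists_hom ((AddMonoidHom.mk' (E P) hE).comp φ) (X := X)
    (fun e h => by simp [hφ, hn])
  refine ⟨(E X).symm u, fun h => (E P).injective ?_⟩
  rw [hn, Equiv.apply_symm_apply, hu]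
  rfl

/-- The coend is computed on a projective generator, as the cokernel of the differences
`eᘁ ▷ P - Pᘁ ◁ e` for `e` in a basis of `End P`. -/
lemma nonempty_of_generator (k : Type w) [Field k] [Linear k C] [MonoidalLinear k C]
    [Projective P] (hP : IsFiniteGenerator P) [Module.Finite k (P ⟶ P)] :
    Nonempty (HandleCoend C) := by
  let b := Module.finBasis k (P ⟶ P)
  let r : (P ⟶ P) →ₗ[k] ((Pᘁ : C) ⊗ P ⟶ (Pᘁ : C) ⊗ P) :=
    { toFun e := eᘁ ▷ P - (Pᘁ : C) ◁ e
      map_add' e f := by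
        rw [rightAdjointMate_add, MonoidalPreadditive.add_whiskerRight,
          MonoidalPreadditive.whiskerLeft_add]
        abel
      map_smul' a e := by
        rw [rightAdjointMate_smul]
        simp [smul_sub] }
  let d := biproduct.desc fun i => r (b i)
  let q := cokernel.π d
  have hr : ∀ {Z : C} (w : (Pᘁ : C) ⊗ P ⟶ Z), (∀ i, r (b i) ≫ w = 0) → ∀ e, r e ≫ w = 0 := by
    intro Z w hw e
    rw [← b.sum_repr e, map_sum, Preadditive.sum_comp]
    refine Finset.sum_eq_zero fun i _ => ?_
    rw [map_smul, Linear.smul_comp, hw, smul_zero]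
  have hq : ∀ e : P ⟶ P, eᘁ ▷ P ≫ q = (Pᘁ : C) ◁ e ≫ q := by
    intro e
    rw [← sub_eq_zero, ← Preadditive.sub_comp]
    refine hr q (fun i => ?_) e
    have : r (b i) = biproduct.ι (fun _ => (Pᘁ : C) ⊗ P) i ≫ d := by simp [d]
    rw [this, Category.assoc, cokernel.condition, comp_zero]
  -- Dinaturality along `h : P ⟶ X` forces these values of the component at `X`. They are `End
  -- P`-linear in `h` precisely because `q` coequalizes the two actions of `End P`.
  have key : ∀ X : C, ∃ u : (Xᘁ : C) ⊗ X ⟶ cokernel d,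
      ∀ h : P ⟶ X, (Xᘁ : C) ◁ h ≫ u = hᘁ ▷ P ≫ q := by
    intro X
    refine tensorLeft_exists_hom hP (AddMonoidHom.mk' (fun h : P ⟶ X => (hᘁ) ▷ P ≫ q) fun a b => ?_)
      fun e h => ?_
    · rw [rightAdjointMate_add, MonoidalPreadditive.add_whiskerRight, Preadditive.add_comp]
    · simp only [AddMonoidHom.mk'_apply, comp_rightAdjointMate, comp_whiskerRight, Category.assoc]
      rw [hq, whisker_exchange_assoc]
  choose ι hι using key
  have hιP : ι P = q := tensorLeft_hom_ext hP fun a => by rw [hι, hq]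
  let c : Cowedge (handleBifunctor C) := Cowedge.mk (cokernel d) ι (fun {X Y} g => by
    change gᘁ ▷ X ≫ ι X = (Yᘁ : C) ◁ g ≫ ι Y
    refine tensorLeft_hom_ext hP fun a => ?_
    rw [whisker_exchange_assoc, hι, ← whiskerLeft_comp_assoc, hι, comp_rightAdjointMate,
      comp_whiskerRight, Category.assoc])
  let w (s : Cowedge (handleBifunctor C)) (X : C) : (Xᘁ : C) ⊗ X ⟶ s.pt := Multicofork.π s X
  have cond : ∀ s : Cowedge (handleBifunctor C), ∀ {X Y : C} (g : X ⟶ Y),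
      gᘁ ▷ X ≫ w s X = (Yᘁ : C) ◁ g ≫ w s Y := fun s _ _ g => s.condition g
  have hd : ∀ s : Cowedge (handleBifunctor C), d ≫ w s P = 0 := by
    intro s
    apply biproduct.hom_ext'
    intro i
    rw [comp_zero, ← Category.assoc]
    simp only [d, biproduct.ι_desc]
    change ((b i)ᘁ ▷ P - (Pᘁ : C) ◁ (b i)) ≫ w s P = 0
    rw [Preadditive.sub_comp, sub_eq_zero]
    exact cond s (b i)
  have fac : ∀ (s : Cowedge (handleBifunctor C)) (X : C),
      ι X ≫ cokernel.desc d (w s P) (hd s) = w s X := by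
    intro s X
    refine tensorLeft_hom_ext hP fun a => ?_
    rw [← Category.assoc, hι, Category.assoc, cokernel.π_desc, cond s a]
  have uniq : ∀ (s : Cowedge (handleBifunctor C)) (m : cokernel d ⟶ s.pt),
      ι P ≫ m = w s P → m = cokernel.desc d (w s P) (hd s) := by
    intro s m hm
    rw [← cancel_epi (cokernel.π d), cokernel.π_desc, ← hm, hιP]
  exact ⟨⟨c, Multicofork.IsColimit.mk _ (fun s => cokernel.desc d (w s P) (hd s)) fac
    fun s m hm => uniq s m (hm P)⟩⟩

lemma nonempty (k : Type w) [Field k] [Linear k C] [MonoidalLinear k C]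
    [IsFiniteTensorCategory k C] : Nonempty (HandleCoend C) := by
  obtain ⟨P, _, hP⟩ := exists_projective_finiteGenerator k C
  have := IsFiniteTensorCategory.finite_hom (k := k) P P
  exact nonempty_of_generator k hP

end HandleCoend

end Existence

/-! ### The universal coaction and the coalgebra structure -/

section Handle

variable {C : Type u} [Category.{v} C] [MonoidalCategory C] [RigidCategory C]

namespace HandleCoend

variable (K : HandleCoend C)

lemma coaction_naturality {X Y : C} (f : X ⟶ Y) :
    f ≫ K.coaction Y = K.coaction X ≫ f ▷ K.obj := by
  have h := coevaluation_comp_rightAdjointMate f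
  calc
    _ = (λ_ X).inv ≫ rightCoev Y ▷ X ≫ (α_ _ _ _).hom ≫ Y ◁ ((Yᘁ : C) ◁ f ≫ K.ι Y) := by
      rw [coaction, leftUnitor_inv_naturality_assoc, whisker_exchange_assoc]
      simp
    _ = (λ_ X).inv ≫ (rightCoev Y ≫ Y ◁ fᘁ) ▷ X ≫ (α_ _ _ _).hom ≫ Y ◁ K.ι X := by
      rw [← K.dinat]
      simp
    _ = _ := by
      rw [h, coaction]
      simp only [comp_whiskerRight, Category.assoc, associator_naturality_left_assoc,
        whisker_exchange]

/-- A zigzag identity recovers `ι_X` from `δ_X`, so the two families carry the same information. -/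
lemma ι_eq (X : C) : K.ι X =
    (Xᘁ : C) ◁ K.coaction X ≫ (α_ _ _ _).inv ≫ rightEv X ▷ K.obj ≫ (λ_ _).hom := by
  have h := ExactPairing.coevaluation_evaluation X (Xᘁ : C)
  calc
    _ = ((ρ_ (Xᘁ : C)).inv ≫ (Xᘁ : C) ◁ rightCoev X ≫ (α_ _ _ _).inv ≫ rightEv X ▷ (Xᘁ : C) ≫
        (λ_ _).hom) ▷ X ≫ K.ι X := by
      simp [rightCoev, rightEv]
    _ = 𝟙 _ ⊗≫ (Xᘁ : C) ◁ rightCoev X ▷ X ⊗≫ (rightEv X ▷ ((Xᘁ : C) ⊗ X) ≫ 𝟙_ C ◁ K.ι X) ⊗≫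
        𝟙 _ := by
      monoidal
    _ = 𝟙 _ ⊗≫ (Xᘁ : C) ◁ rightCoev X ▷ X ⊗≫
        (((Xᘁ : C) ⊗ X) ◁ K.ι X ≫ rightEv X ▷ K.obj) ⊗≫ 𝟙 _ := by
      rw [whisker_exchange]
    _ = _ := by
      rw [coaction]
      monoidal

/-- The main tool for proving equations: by `ι_eq`, testing against all coactions is as good as
testing against the dinatural family. -/
lemma hom_ext_coaction {Z : C} {f g : K.obj ⟶ Z}
    (h : ∀ X, K.coaction X ≫ X ◁ f = K.coaction X ≫ X ◁ g) : f = g := by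
  have key : ∀ (f : K.obj ⟶ Z) (X : C), K.ι X ≫ f =
      (Xᘁ : C) ◁ (K.coaction X ≫ X ◁ f) ≫ (α_ _ _ _).inv ≫ rightEv X ▷ Z ≫ (λ_ _).hom := by
    intro f X
    calc
      _ = 𝟙 _ ⊗≫ (Xᘁ : C) ◁ K.coaction X ⊗≫ (rightEv X ▷ K.obj ≫ 𝟙_ C ◁ f) ⊗≫ 𝟙 _ := by
        rw [ι_eq]; monoidal
      _ = _ := by
        rw [← whisker_exchange]; monoidal
  apply K.hom_ext
  intro X
  rw [key, key, h]

lemma hom_ext_coaction_right {Y Z : C} {f g : K.obj ⊗ Y ⟶ Z}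
    (h : ∀ X, K.coaction X ▷ Y ≫ (α_ X K.obj Y).hom ≫ X ◁ f =
      K.coaction X ▷ Y ≫ (α_ X K.obj Y).hom ≫ X ◁ g) : f = g := by
  have key : ∀ (f : K.obj ⊗ Y ⟶ Z) (X : C), K.ι X ▷ Y ≫ f =
      (α_ _ _ _).hom ≫ (Xᘁ : C) ◁ (K.coaction X ▷ Y ≫ (α_ X K.obj Y).hom ≫ X ◁ f) ≫
        (α_ _ _ _).inv ≫ rightEv X ▷ Z ≫ (λ_ _).hom := by
    intro f X
    calc
      _ = 𝟙 _ ⊗≫ (Xᘁ : C) ◁ K.coaction X ▷ Y ⊗≫ (rightEv X ▷ (K.obj ⊗ Y) ≫ 𝟙_ C ◁ f) ⊗≫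
          𝟙 _ := by
        rw [ι_eq]; monoidal
      _ = _ := by
        rw [← whisker_exchange]; monoidal
  apply K.hom_ext_right
  intro X
  rw [key, key, h]

/-- A morphism out of the coend is determined on `δ_X` by its values on the family `ι`. -/
lemma coaction_whiskerLeft {Z : C} (f : K.obj ⟶ Z) (X : C) : K.coaction X ≫ X ◁ f =
    (λ_ X).inv ≫ rightCoev X ▷ X ≫ (α_ _ _ _).hom ≫ X ◁ (K.ι X ≫ f) := by
  simp [coaction]

lemma coaction_counit (X : C) : K.coaction X ≫ X ◁ K.counit = (ρ_ X).inv := by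
  rw [coaction_whiskerLeft, counit, ι_desc]
  have h := ExactPairing.evaluation_coevaluation X (Xᘁ : C)
  simp [rightCoev, rightEv, h]

/-- Both sides insert two coevaluations and apply `ι` twice; they differ only by interchange. -/
lemma coaction_comul (X : C) : K.coaction X ≫ X ◁ K.comul =
    K.coaction X ≫ K.coaction X ▷ K.obj ≫ (α_ X K.obj K.obj).hom := by
  rw [coaction_whiskerLeft, comul, ι_desc, comulFamily, coaction]
  rw [MonoidalCategory.tensorHom_def]
  calc
    _ = 𝟙 _ ⊗≫ rightCoev X ▷ X ⊗≫ X ◁ (Xᘁ : C) ◁ rightCoev X ▷ X ⊗≫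
        X ◁ (K.ι X ▷ ((Xᘁ : C) ⊗ X) ≫ K.obj ◁ K.ι X) ⊗≫ 𝟙 _ := by
      monoidal
    _ = 𝟙 _ ⊗≫ (rightCoev X ▷ (𝟙_ C ⊗ X) ≫ (X ⊗ (Xᘁ : C)) ◁ rightCoev X ▷ X) ⊗≫
        X ◁ ((Xᘁ : C) ⊗ X) ◁ K.ι X ⊗≫ X ◁ (K.ι X ▷ K.obj) ⊗≫ 𝟙 _ := by
      rw [← whisker_exchange]; monoidal
    _ = 𝟙 _ ⊗≫ rightCoev X ▷ X ⊗≫ (rightCoev X ▷ (X ⊗ ((Xᘁ : C) ⊗ X)) ≫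
        (X ⊗ (Xᘁ : C)) ◁ (X ◁ K.ι X)) ⊗≫ X ◁ (K.ι X ▷ K.obj) ⊗≫ 𝟙 _ := by
      rw [← whisker_exchange]; monoidal
    _ = _ := by
      rw [← whisker_exchange]; monoidal

lemma ι_comul (X : C) : K.ι X ≫ K.comul =
    (Xᘁ : C) ◁ K.coaction X ≫ (α_ _ _ _).inv ≫ K.ι X ▷ K.obj := by
  rw [comul, ι_desc, comulFamily, coaction, tensorHom_def']
  simp

lemma coaction_unit : K.coaction (𝟙_ C) = K.one ≫ (λ_ _).inv := by
  rw [coaction, one]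
  calc
    _ = 𝟙 _ ⊗≫ rightCoev (𝟙_ C) ⊗≫ K.ι (𝟙_ C) ⊗≫ 𝟙 _ := by monoidal
    _ = _ := by monoidal

lemma counit_comul : K.comul ≫ K.counit ▷ K.obj = (λ_ _).inv := by
  apply K.hom_ext_coaction
  intro X
  rw [whiskerLeft_comp, reassoc_of% K.coaction_comul]
  calc
    _ = K.coaction X ≫ (K.coaction X ≫ X ◁ K.counit) ▷ K.obj ⊗≫ 𝟙 _ := by monoidal
    _ = _ := by rw [coaction_counit]; monoidal

lemma comul_counit : K.comul ≫ K.obj ◁ K.counit = (ρ_ _).inv := by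
  apply K.hom_ext_coaction
  intro X
  rw [whiskerLeft_comp, reassoc_of% K.coaction_comul]
  calc
    _ = K.coaction X ≫ (K.coaction X ▷ K.obj ≫ (X ⊗ K.obj) ◁ K.counit) ⊗≫ 𝟙 _ := by monoidal
    _ = (K.coaction X ≫ X ◁ K.counit) ⊗≫ K.coaction X ⊗≫ 𝟙 _ := by
      rw [← whisker_exchange]; monoidal
    _ = _ := by rw [coaction_counit]; monoidal

lemma comul_assoc : K.comul ≫ K.obj ◁ K.comul =
    K.comul ≫ K.comul ▷ K.obj ≫ (α_ K.obj K.obj K.obj).hom := by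
  apply K.hom_ext_coaction
  intro X
  simp only [whiskerLeft_comp, reassoc_of% K.coaction_comul]
  calc
    _ = K.coaction X ≫ (K.coaction X ▷ K.obj ≫ (X ⊗ K.obj) ◁ K.comul) ⊗≫ 𝟙 _ := by monoidal
    _ = (K.coaction X ≫ X ◁ K.comul) ⊗≫ K.coaction X ▷ (K.obj ⊗ K.obj) ⊗≫ 𝟙 _ := by
      rw [← whisker_exchange]; monoidal
    _ = K.coaction X ≫ (K.coaction X ≫ K.coaction X ▷ K.obj) ▷ K.obj ⊗≫ 𝟙 _ := by
      rw [coaction_comul]; monoidal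
    _ = K.coaction X ≫ (K.coaction X ≫ X ◁ K.comul) ▷ K.obj ⊗≫ 𝟙 _ := by
      rw [coaction_comul]; monoidal
    _ = _ := by monoidal

lemma one_counit : K.one ≫ K.counit = 𝟙 _ := by
  have h := K.coaction_counit (𝟙_ C)
  rw [coaction_unit] at h
  calc
    _ = ((K.one ≫ (λ_ K.obj).inv) ≫ 𝟙_ C ◁ K.counit) ≫ (λ_ _).hom := by simp
    _ = _ := by rw [h]; monoidal

lemma one_comul : K.one ≫ K.comul = (λ_ (𝟙_ C)).inv ≫ (K.one ⊗ₘ K.one) := by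
  have h := K.coaction_comul (𝟙_ C)
  rw [coaction_unit] at h
  calc
    _ = ((K.one ≫ (λ_ K.obj).inv) ≫ 𝟙_ C ◁ K.comul) ≫ (λ_ _).hom := by simp
    _ = 𝟙 _ ⊗≫ (𝟙_ C ◁ K.one ≫ K.one ▷ K.obj) ⊗≫ 𝟙 _ := by rw [h]; monoidal
    _ = _ := by rw [whisker_exchange, MonoidalCategory.tensorHom_def]; monoidal

end HandleCoend

end Handle

/-! ### Coactions on tensor products -/

section Product

variable {C : Type u} [Category.{v} C] [MonoidalCategory C] [RigidCategory C]

/-- `dualTensor` is the comparison between two duals of `V ⊗ U`, so it carries the nested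
coevaluation to the chosen one. -/
lemma rightCoev_tensor (V U : C) : rightCoev (V ⊗ U) =
    (rightCoev V ≫ V ◁ ((λ_ _).inv ≫ rightCoev U ▷ (Vᘁ : C) ≫ (α_ _ _ _).hom) ≫
      (α_ _ _ _).inv) ≫ (V ⊗ U) ◁ dualTensor U V := by
  have h := @coevaluation_comp_rightAdjointMate C _ _ (V ⊗ U) (V ⊗ U)
    (RightRigidCategory.rightDual (V ⊗ U)) ⟨(Uᘁ : C) ⊗ (Vᘁ : C)⟩ (𝟙 (V ⊗ U))
  rw [id_whiskerRight, Category.comp_id] at h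
  refine h.symm.trans (congrArg (· ≫ (V ⊗ U) ◁ dualTensor U V) ?_)
  refine (ExactPairing.tensor_coevaluation (X₁ := V) (X₂ := U) (Y₁ := (Vᘁ : C))
    (Y₂ := (Uᘁ : C))).trans ?_
  monoidal

namespace HandleCoend

variable [BraidedCategory C] (K : HandleCoend C)

/-- The action unfolds to a double braiding between a coevaluation and an evaluation, and the zigzag
identity removes these two. -/
lemma coaction_action (X Y : C) :
    K.coaction X ▷ Y ≫ (α_ X K.obj Y).hom ≫ X ◁ K.action Y = (β_ X Y).hom ≫ (β_ Y X).hom := by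
  have h1 : K.ι X ▷ Y ≫ K.action Y = (α_ _ _ _).hom ≫ (Xᘁ : C) ◁ ((β_ X Y).hom ≫ (β_ Y X).hom) ≫
      (α_ _ _ _).inv ≫ rightEv X ▷ Y ≫ (λ_ Y).hom := by
    rw [action, partialMonodromy, ← Category.assoc, ι_descRight, monodromyFamily]
    simp only [Category.assoc, ← comp_whiskerRight_assoc, counit, ι_desc]
  have h2 := ExactPairing.evaluation_coevaluation X (Xᘁ : C)
  calc
    _ = (λ_ _).inv ≫ (α_ _ _ _).inv ≫ ((rightCoev X ▷ X ≫ (α_ _ _ _).hom) ▷ Y) ≫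
        (α_ _ _ _).hom ≫ X ◁ (K.ι X ▷ Y ≫ K.action Y) := by
      rw [coaction]; monoidal
    _ = 𝟙 _ ⊗≫ (rightCoev X ▷ (X ⊗ Y) ≫ (X ⊗ (Xᘁ : C)) ◁ ((β_ X Y).hom ≫ (β_ Y X).hom)) ⊗≫
        X ◁ rightEv X ▷ Y ⊗≫ 𝟙 _ := by
      rw [h1]; monoidal
    _ = ((β_ X Y).hom ≫ (β_ Y X).hom) ≫ (λ_ _).inv ≫ (α_ _ _ _).inv ≫
      ((rightCoev X ▷ X ≫ (α_ _ _ _).hom ≫ X ◁ rightEv X) ▷ Y) ≫ (ρ_ X).hom ▷ Y := by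
      rw [← whisker_exchange]; monoidal
    _ = _ := by
      simp [rightCoev, rightEv, h2]

/-- The coaction of a tensor product, with the inverse braiding. -/
lemma coaction_tensor_inv (V U : C) : K.coaction (V ⊗ U) =
    K.coaction V ▷ U ≫ (α_ V K.obj U).hom ≫ V ◁ ((β_ U K.obj).inv ≫ K.coaction U ▷ K.obj ≫
      (α_ U K.obj K.obj).hom ≫ U ◁ K.mul) ≫ (α_ V U K.obj).inv := by
  -- The defining relation of the product, solved for `ι` at a tensor product; this is where the
  -- inverse braiding enters.
  have h1 : dualTensor U V ▷ (V ⊗ U) ≫ K.ι (V ⊗ U) =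
      (α_ _ _ _).hom ≫ (Uᘁ : C) ◁ ((α_ _ _ _).inv ≫ (β_ U ((Vᘁ : C) ⊗ V)).inv) ≫
        (α_ _ _ _).inv ≫ (K.ι U ⊗ₘ K.ι V) ≫ K.mul := by
    rw [ι_mul, mulFamily, mulPerm]
    simp
  calc
    _ = (λ_ _).inv ≫ (rightCoev V ≫ V ◁ ((λ_ _).inv ≫ rightCoev U ▷ (Vᘁ : C) ≫ (α_ _ _ _).hom) ≫
      (α_ _ _ _).inv) ▷ (V ⊗ U) ≫ (α_ _ _ _).hom ≫ (V ⊗ U) ◁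
        (dualTensor U V ▷ (V ⊗ U) ≫ K.ι (V ⊗ U)) := by
      rw [coaction, rightCoev_tensor]; monoidal
    _ = 𝟙 _ ⊗≫ rightCoev V ▷ (V ⊗ U) ⊗≫ V ◁ rightCoev U ▷ ((Vᘁ : C) ⊗ V ⊗ U) ⊗≫
        (V ⊗ U ⊗ (Uᘁ : C)) ◁ (β_ U ((Vᘁ : C) ⊗ V)).inv ⊗≫
        (V ⊗ U) ◁ (K.ι U ▷ ((Vᘁ : C) ⊗ V) ≫ K.obj ◁ K.ι V) ⊗≫ (V ⊗ U) ◁ K.mul ⊗≫ 𝟙 _ := by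
      rw [h1, MonoidalCategory.tensorHom_def]; monoidal
    _ = 𝟙 _ ⊗≫ rightCoev V ▷ (V ⊗ U) ⊗≫ V ◁ rightCoev U ▷ ((Vᘁ : C) ⊗ V ⊗ U) ⊗≫
        (V ⊗ U ⊗ (Uᘁ : C)) ◁ ((β_ U ((Vᘁ : C) ⊗ V)).inv ≫ U ◁ K.ι V) ⊗≫
        (V ⊗ U) ◁ (K.ι U ▷ K.obj) ⊗≫ (V ⊗ U) ◁ K.mul ⊗≫ 𝟙 _ := by
      rw [← whisker_exchange]; monoidal
    _ = 𝟙 _ ⊗≫ rightCoev V ▷ (V ⊗ U) ⊗≫ V ◁ (rightCoev U ▷ (((Vᘁ : C) ⊗ V) ⊗ U) ≫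
        (U ⊗ (Uᘁ : C)) ◁ (K.ι V ▷ U ≫ (β_ U K.obj).inv)) ⊗≫
        (V ⊗ U) ◁ (K.ι U ▷ K.obj) ⊗≫ (V ⊗ U) ◁ K.mul ⊗≫ 𝟙 _ := by
      rw [← BraidedCategory.braiding_inv_naturality_left]; monoidal
    _ = _ := by
      rw [← whisker_exchange, coaction, coaction]; monoidal

/-- The coaction of a tensor product, with the braiding. -/
lemma coaction_tensor (V U : C) : K.coaction (V ⊗ U) =
    K.coaction V ▷ U ≫ (α_ V K.obj U).hom ≫ V ◁ (K.obj ◁ K.coaction U ≫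
      (α_ _ _ _).inv ≫ (β_ K.obj U).hom ▷ K.obj ≫ (α_ U K.obj K.obj).hom ≫ U ◁ K.mul) ≫
      (α_ V U K.obj).inv := by
  -- Conjugating the previous formula by `β_ V U` exchanges the two factors: the inverse braiding
  -- cancels and the order of multiplication is reversed.
  have h := K.coaction_naturality (β_ V U).hom
  rw [← cancel_mono ((β_ V U).hom ▷ K.obj), ← h, coaction_tensor_inv]
  calc
    _ = 𝟙 _ ⊗≫ ((β_ V U).hom ≫ K.coaction U ▷ V) ⊗≫ U ◁ (β_ V K.obj).inv ⊗≫
        U ◁ K.coaction V ▷ K.obj ⊗≫ (U ⊗ V) ◁ K.mul ⊗≫ 𝟙 _ := by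
      monoidal
    _ = 𝟙 _ ⊗≫ (V ◁ K.coaction U ≫ (β_ V (U ⊗ K.obj)).hom) ⊗≫ U ◁ (β_ V K.obj).inv ⊗≫
        U ◁ K.coaction V ▷ K.obj ⊗≫ (U ⊗ V) ◁ K.mul ⊗≫ 𝟙 _ := by
      rw [BraidedCategory.braiding_naturality_right]
    _ = 𝟙 _ ⊗≫ V ◁ K.coaction U ⊗≫ (β_ V U).hom ▷ K.obj ⊗≫
        U ◁ ((β_ V K.obj).hom ≫ (β_ V K.obj).inv) ⊗≫
        U ◁ K.coaction V ▷ K.obj ⊗≫ (U ⊗ V) ◁ K.mul ⊗≫ 𝟙 _ := by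
      rw [BraidedCategory.braiding_tensor_right_hom]; monoidal
    _ = 𝟙 _ ⊗≫ V ◁ K.coaction U ⊗≫ ((β_ V U).hom ≫ U ◁ K.coaction V) ▷ K.obj ⊗≫
        (U ⊗ V) ◁ K.mul ⊗≫ 𝟙 _ := by
      rw [Iso.hom_inv_id]; monoidal
    _ = 𝟙 _ ⊗≫ (V ◁ K.coaction U ≫ K.coaction V ▷ (U ⊗ K.obj)) ⊗≫
        (β_ (V ⊗ K.obj) U).hom ▷ K.obj ⊗≫ (U ⊗ V) ◁ K.mul ⊗≫ 𝟙 _ := by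
      rw [← BraidedCategory.braiding_naturality_left]; monoidal
    _ = 𝟙 _ ⊗≫ K.coaction V ▷ U ⊗≫ (V ⊗ K.obj) ◁ K.coaction U ⊗≫
        V ◁ (β_ K.obj U).hom ▷ K.obj ⊗≫ ((β_ V U).hom ▷ (K.obj ⊗ K.obj) ≫ (U ⊗ V) ◁ K.mul) ⊗≫
        𝟙 _ := by
      rw [whisker_exchange, BraidedCategory.braiding_tensor_left_hom]; monoidal
    _ = _ := by
      rw [← whisker_exchange]; monoidal

end HandleCoend

end Product

/-! ### The bialgebra axioms -/

section Bialgebra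

variable {C : Type u} [Category.{v} C] [MonoidalCategory C] [RigidCategory C]

namespace HandleCoend

variable [BraidedCategory C] (K : HandleCoend C)

/-- The coactions of two objects, with both copies of the coend moved to the right. -/
def coactionPair (V U : C) : V ⊗ U ⟶ (V ⊗ U) ⊗ (K.obj ⊗ K.obj) :=
  K.coaction V ▷ U ≫ (α_ V K.obj U).hom ≫ V ◁ (K.obj ◁ K.coaction U ≫
    (α_ _ _ _).inv ≫ (β_ K.obj U).hom ▷ K.obj ≫ (α_ U K.obj K.obj).hom) ≫
    (α_ V U (K.obj ⊗ K.obj)).inv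

lemma coactionPair_mul (V U : C) :
    K.coactionPair V U ≫ (V ⊗ U) ◁ K.mul = K.coaction (V ⊗ U) := by
  rw [coaction_tensor, coactionPair]
  simp

/-- Braiding `A` to the far right exposes `K` as the leftmost factor, where the earlier criterion
applies. This gives access to further copies of `K`. -/
lemma hom_ext_coaction_middle {A Y Z : C} {f g : A ⊗ (K.obj ⊗ Y) ⟶ Z}
    (h : ∀ U, A ◁ K.coaction U ▷ Y ≫ A ◁ (α_ _ _ _).hom ≫ (α_ _ _ _).inv ≫
        (β_ A U).hom ▷ (K.obj ⊗ Y) ≫ (α_ _ _ _).hom ≫ U ◁ f =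
      A ◁ K.coaction U ▷ Y ≫ A ◁ (α_ _ _ _).hom ≫ (α_ _ _ _).inv ≫
        (β_ A U).hom ▷ (K.obj ⊗ Y) ≫ (α_ _ _ _).hom ≫ U ◁ g) : f = g := by
  rw [← cancel_epi ((α_ K.obj Y A).inv ≫ (β_ A (K.obj ⊗ Y)).inv)]
  apply K.hom_ext_coaction_right
  intro U
  have key : ∀ f : A ⊗ (K.obj ⊗ Y) ⟶ Z, K.coaction U ▷ (Y ⊗ A) ≫ (α_ _ _ _).hom ≫
      U ◁ (((α_ K.obj Y A).inv ≫ (β_ A (K.obj ⊗ Y)).inv) ≫ f) =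
      (α_ _ _ _).inv ≫ (β_ A (U ⊗ Y)).inv ≫ A ◁ K.coaction U ▷ Y ≫ A ◁ (α_ _ _ _).hom ≫
        (α_ _ _ _).inv ≫ (β_ A U).hom ▷ (K.obj ⊗ Y) ≫ (α_ _ _ _).hom ≫ U ◁ f := by
    intro f
    symm
    calc
      _ = 𝟙 _ ⊗≫ ((β_ A (U ⊗ Y)).inv ≫ A ◁ (K.coaction U ▷ Y ≫ (α_ _ _ _).hom)) ⊗≫
          (β_ A U).hom ▷ (K.obj ⊗ Y) ⊗≫ U ◁ f := by
        monoidal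
      _ = 𝟙 _ ⊗≫ K.coaction U ▷ Y ▷ A ⊗≫ U ◁ (β_ A (K.obj ⊗ Y)).inv ⊗≫
          ((β_ A U).inv ≫ (β_ A U).hom) ▷ (K.obj ⊗ Y) ⊗≫ U ◁ f := by
        rw [← BraidedCategory.braiding_inv_naturality_left,
          BraidedCategory.braiding_tensor_right_inv A U (K.obj ⊗ Y)]
        monoidal
      _ = _ := by
        rw [Iso.inv_hom_id]
        monoidal
  rw [key, key, h]

lemma hom_ext_coactionPair {Y Z : C} {f g : (K.obj ⊗ K.obj) ⊗ Y ⟶ Z}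
    (h : ∀ V U, K.coactionPair V U ▷ Y ≫ (α_ _ _ _).hom ≫ (V ⊗ U) ◁ f =
      K.coactionPair V U ▷ Y ≫ (α_ _ _ _).hom ≫ (V ⊗ U) ◁ g) : f = g := by
  rw [← cancel_epi (α_ K.obj K.obj Y).inv]
  apply K.hom_ext_coaction_middle
  intro U
  apply K.hom_ext_coaction_right
  intro V
  have key : ∀ f : (K.obj ⊗ K.obj) ⊗ Y ⟶ Z, K.coaction V ▷ (U ⊗ Y) ≫ (α_ _ _ _).hom ≫
      V ◁ (K.obj ◁ K.coaction U ▷ Y ≫ K.obj ◁ (α_ _ _ _).hom ≫ (α_ _ _ _).inv ≫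
        (β_ K.obj U).hom ▷ (K.obj ⊗ Y) ≫ (α_ _ _ _).hom ≫ U ◁ ((α_ _ _ _).inv ≫ f)) =
      (α_ _ _ _).inv ≫ (K.coactionPair V U ▷ Y ≫ (α_ _ _ _).hom ≫ (V ⊗ U) ◁ f) ≫
        (α_ _ _ _).hom := by
    intro f
    rw [coactionPair]
    monoidal
  rw [key, key, h]

lemma hom_ext_coactionPair' {Z : C} {f g : K.obj ⊗ K.obj ⟶ Z}
    (h : ∀ V U, K.coactionPair V U ≫ (V ⊗ U) ◁ f = K.coactionPair V U ≫ (V ⊗ U) ◁ g) :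
    f = g := by
  rw [← cancel_epi (ρ_ _).hom]
  apply K.hom_ext_coactionPair
  intro V U
  have key : ∀ f : K.obj ⊗ K.obj ⟶ Z, K.coactionPair V U ▷ (𝟙_ C) ≫ (α_ _ _ _).hom ≫
      (V ⊗ U) ◁ ((ρ_ _).hom ≫ f) = (ρ_ _).hom ≫ K.coactionPair V U ≫ (V ⊗ U) ◁ f := by
    intro f
    monoidal
  rw [key, key, h]

/-- Naturality of `δ` along the left unitor, with `δ` at the tensor unit equal to `one` up to a
unitor. -/
lemma one_mul : K.one ▷ K.obj ≫ K.mul = (λ_ _).hom := by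
  rw [← cancel_epi (λ_ K.obj).inv, Iso.inv_hom_id]
  apply K.hom_ext_coaction
  intro U
  have h := K.coaction_naturality (λ_ U).hom
  rw [coaction_tensor, coaction_unit] at h
  rw [← cancel_epi (λ_ U).hom, whiskerLeft_id, Category.comp_id, h]
  symm
  calc
    _ = 𝟙 _ ⊗≫ (K.one ▷ U ≫ K.obj ◁ K.coaction U) ⊗≫ (β_ K.obj U).hom ▷ K.obj ⊗≫
        U ◁ K.mul := by
      monoidal
    _ = 𝟙 _ ⊗≫ K.coaction U ⊗≫ (K.one ▷ U ≫ (β_ K.obj U).hom) ▷ K.obj ⊗≫ U ◁ K.mul := by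
      rw [← whisker_exchange]; monoidal
    _ = _ := by
      rw [BraidedCategory.braiding_naturality_left, braiding_tensorUnit_left]; monoidal

lemma mul_one : K.obj ◁ K.one ≫ K.mul = (ρ_ _).hom := by
  rw [← cancel_epi (ρ_ K.obj).inv, Iso.inv_hom_id]
  apply K.hom_ext_coaction
  intro U
  have h := K.coaction_naturality (ρ_ U).hom
  rw [coaction_tensor, coaction_unit] at h
  rw [← cancel_epi (ρ_ U).hom, whiskerLeft_id, Category.comp_id, h]
  symm
  calc
    _ = 𝟙 _ ⊗≫ K.coaction U ⊗≫ U ◁ K.obj ◁ K.one ⊗≫ U ◁ (β_ K.obj (𝟙_ C)).hom ▷ K.obj ⊗≫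
        U ◁ K.mul := by
      monoidal
    _ = _ := by
      rw [braiding_tensorUnit_right]; monoidal

/-- Tested on three objects, both bracketings compute the coaction of the triple tensor product;
naturality along the associator identifies them. -/
lemma mul_assoc : K.mul ▷ K.obj ≫ K.mul =
    (α_ K.obj K.obj K.obj).hom ≫ K.obj ◁ K.mul ≫ K.mul := by
  -- A trailing tensor unit plays the role of `Y` in the extensionality lemma.
  rw [← cancel_epi ((K.obj ⊗ K.obj) ◁ (ρ_ K.obj).hom)]
  apply K.hom_ext_coaction_middle
  intro U
  apply K.hom_ext_coactionPair
  intro W V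
  have h := K.coaction_naturality (α_ W V U).hom
  trans 𝟙 _ ⊗≫ K.coaction ((W ⊗ V) ⊗ U) ⊗≫ 𝟙 _
  · rw [K.coaction_tensor (W ⊗ V) U, ← coactionPair_mul]
    symm
    calc
      _ = 𝟙 _ ⊗≫ K.coactionPair W V ▷ U ⊗≫ (W ⊗ V) ◁ (K.mul ▷ U ≫ K.obj ◁ K.coaction U) ⊗≫
          (W ⊗ V) ◁ (β_ K.obj U).hom ▷ K.obj ⊗≫ ((W ⊗ V) ⊗ U) ◁ K.mul ⊗≫ 𝟙 _ := by
        monoidal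
      _ = 𝟙 _ ⊗≫ K.coactionPair W V ▷ U ⊗≫ (W ⊗ V) ◁ ((K.obj ⊗ K.obj) ◁ K.coaction U) ⊗≫
          (W ⊗ V) ◁ (K.mul ▷ U ≫ (β_ K.obj U).hom) ▷ K.obj ⊗≫ ((W ⊗ V) ⊗ U) ◁ K.mul ⊗≫
          𝟙 _ := by
        rw [← whisker_exchange]; monoidal
      _ = _ := by
        rw [BraidedCategory.braiding_naturality_left]; monoidal
  · have h' : K.coaction ((W ⊗ V) ⊗ U) =
        (α_ W V U).hom ≫ K.coaction (W ⊗ (V ⊗ U)) ≫ (α_ W V U).inv ▷ K.obj := by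
      rw [reassoc_of% h]; simp
    rw [h', K.coaction_tensor W (V ⊗ U), ← coactionPair_mul]
    calc
      _ = 𝟙 _ ⊗≫ K.coaction W ▷ (V ⊗ U) ⊗≫ W ◁ K.obj ◁ K.coactionPair V U ⊗≫
          W ◁ (K.obj ◁ ((V ⊗ U) ◁ K.mul) ⊗≫ (β_ K.obj (V ⊗ U)).hom ▷ K.obj) ⊗≫
          (W ⊗ V ⊗ U) ◁ K.mul ⊗≫ 𝟙 _ := by
        monoidal
      _ = 𝟙 _ ⊗≫ K.coaction W ▷ (V ⊗ U) ⊗≫ W ◁ K.obj ◁ K.coactionPair V U ⊗≫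
          W ◁ ((K.obj ⊗ V ⊗ U) ◁ K.mul ≫ (β_ K.obj (V ⊗ U)).hom ▷ K.obj) ⊗≫
          (W ⊗ V ⊗ U) ◁ K.mul ⊗≫ 𝟙 _ := by
        monoidal
      _ = 𝟙 _ ⊗≫ K.coaction W ▷ (V ⊗ U) ⊗≫ W ◁ K.obj ◁ K.coaction V ▷ U ⊗≫
          W ◁ (K.obj ⊗ V ⊗ K.obj) ◁ K.coaction U ⊗≫
          W ◁ ((K.obj ⊗ V) ◁ (β_ K.obj U).hom ≫ (β_ K.obj V).hom ▷ (U ⊗ K.obj)) ▷ K.obj ⊗≫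
          W ◁ V ◁ (β_ K.obj U).hom ▷ (K.obj ⊗ K.obj) ⊗≫
          (W ⊗ V ⊗ U) ◁ (K.obj ◁ K.mul ≫ K.mul) ⊗≫ 𝟙 _ := by
        rw [whisker_exchange, coactionPair, BraidedCategory.braiding_tensor_right_hom]; monoidal
      _ = 𝟙 _ ⊗≫ K.coaction W ▷ (V ⊗ U) ⊗≫ W ◁ K.obj ◁ K.coaction V ▷ U ⊗≫
          W ◁ ((K.obj ⊗ V) ◁ (K.obj ◁ K.coaction U) ≫
            (β_ K.obj V).hom ▷ (K.obj ⊗ U ⊗ K.obj)) ⊗≫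
          W ◁ V ◁ K.obj ◁ (β_ K.obj U).hom ▷ K.obj ⊗≫
          W ◁ V ◁ (β_ K.obj U).hom ▷ (K.obj ⊗ K.obj) ⊗≫
          (W ⊗ V ⊗ U) ◁ (K.obj ◁ K.mul ≫ K.mul) ⊗≫ 𝟙 _ := by
        rw [whisker_exchange]; monoidal
      _ = _ := by
        rw [whisker_exchange, coactionPair, BraidedCategory.braiding_tensor_left_hom]; monoidal

lemma coactionPair_counit (V U : C) :
    K.coactionPair V U ≫ (V ⊗ U) ◁ (K.counit ⊗ₘ K.counit) =
      (ρ_ _).inv ≫ (V ⊗ U) ◁ (λ_ (𝟙_ C)).inv := by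
  calc
    _ = 𝟙 _ ⊗≫ K.coaction V ▷ U ⊗≫ V ◁ K.obj ◁ K.coaction U ⊗≫
        V ◁ ((β_ K.obj U).hom ≫ U ◁ K.counit) ▷ K.obj ⊗≫ (V ⊗ U) ◁ K.counit ⊗≫ 𝟙 _ := by
      rw [coactionPair, MonoidalCategory.tensorHom_def]; monoidal
    _ = 𝟙 _ ⊗≫ K.coaction V ▷ U ⊗≫ V ◁ (K.obj ◁ K.coaction U ≫ K.counit ▷ (U ⊗ K.obj)) ⊗≫
        (V ⊗ U) ◁ K.counit ⊗≫ 𝟙 _ := by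
      rw [← BraidedCategory.braiding_naturality_left, braiding_tensorUnit_left]; monoidal
    _ = 𝟙 _ ⊗≫ (K.coaction V ≫ V ◁ K.counit) ▷ U ⊗≫ V ◁ (K.coaction U ≫ U ◁ K.counit) ⊗≫ 𝟙 _ := by
      rw [whisker_exchange]; monoidal
    _ = _ := by rw [coaction_counit, coaction_counit]; monoidal

lemma mul_counit : K.mul ≫ K.counit = (K.counit ⊗ₘ K.counit) ≫ (λ_ (𝟙_ C)).hom := by
  apply K.hom_ext_coactionPair'
  intro V U
  rw [whiskerLeft_comp, reassoc_of% K.coactionPair_mul, coaction_counit, whiskerLeft_comp,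
    reassoc_of% K.coactionPair_counit]
  simp

/-- The paired coaction is coassociative for the tensor product coalgebra `K ⊗ K`, whose coproduct
involves `tensorμ`. -/
lemma coactionPair_comul (V U : C) :
    K.coactionPair V U ≫ K.coactionPair V U ▷ (K.obj ⊗ K.obj) ≫ (α_ _ _ _).hom =
      K.coactionPair V U ≫ (V ⊗ U) ◁ ((K.comul ⊗ₘ K.comul) ≫
        tensorμ K.obj K.obj K.obj K.obj) := by
  symm
  calc
    _ = 𝟙 _ ⊗≫ K.coaction V ▷ U ⊗≫ V ◁ K.obj ◁ K.coaction U ⊗≫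
        V ◁ ((β_ K.obj U).hom ≫ U ◁ K.comul) ▷ K.obj ⊗≫
        (V ⊗ U ⊗ K.obj ⊗ K.obj) ◁ K.comul ⊗≫
        (V ⊗ U ⊗ K.obj) ◁ (β_ K.obj K.obj).hom ▷ K.obj ⊗≫ 𝟙 _ := by
      rw [coactionPair, MonoidalCategory.tensorHom_def, tensorμ]; monoidal
    _ = 𝟙 _ ⊗≫ K.coaction V ▷ U ⊗≫
        V ◁ (K.obj ◁ K.coaction U ≫ K.comul ▷ (U ⊗ K.obj)) ⊗≫
        V ◁ ((β_ (K.obj ⊗ K.obj) U).hom ▷ K.obj ≫ (U ⊗ K.obj ⊗ K.obj) ◁ K.comul) ⊗≫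
        (V ⊗ U ⊗ K.obj) ◁ (β_ K.obj K.obj).hom ▷ K.obj ⊗≫ 𝟙 _ := by
      rw [← BraidedCategory.braiding_naturality_left]; monoidal
    _ = 𝟙 _ ⊗≫ (K.coaction V ≫ V ◁ K.comul) ▷ U ⊗≫
        V ◁ (K.obj ⊗ K.obj) ◁ (K.coaction U ≫ U ◁ K.comul) ⊗≫
        V ◁ (β_ (K.obj ⊗ K.obj) U).hom ▷ (K.obj ⊗ K.obj) ⊗≫
        (V ⊗ U ⊗ K.obj) ◁ (β_ K.obj K.obj).hom ▷ K.obj ⊗≫ 𝟙 _ := by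
      rw [whisker_exchange K.comul, ← whisker_exchange _ K.comul]; monoidal
    _ = 𝟙 _ ⊗≫ K.coaction V ▷ U ⊗≫ (K.coaction V ▷ (K.obj ⊗ U) ≫
        (V ⊗ K.obj) ◁ (K.obj ◁ K.coaction U)) ⊗≫
        V ◁ K.obj ◁ K.obj ◁ K.coaction U ▷ K.obj ⊗≫
        V ◁ K.obj ◁ (β_ K.obj U).hom ▷ (K.obj ⊗ K.obj) ⊗≫
        V ◁ ((β_ K.obj U).hom ▷ (K.obj ⊗ K.obj) ≫
        (U ⊗ K.obj) ◁ (β_ K.obj K.obj).hom) ▷ K.obj ⊗≫ 𝟙 _ := by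
      rw [coaction_comul, coaction_comul, BraidedCategory.braiding_tensor_left_hom]; monoidal
    _ = 𝟙 _ ⊗≫ K.coaction V ▷ U ⊗≫ V ◁ K.obj ◁ K.coaction U ⊗≫
        K.coaction V ▷ (K.obj ⊗ U ⊗ K.obj) ⊗≫
        V ◁ K.obj ◁ (K.obj ◁ K.coaction U ≫ (β_ K.obj (U ⊗ K.obj)).hom) ▷ K.obj ⊗≫
        V ◁ (β_ K.obj U).hom ▷ (K.obj ⊗ K.obj ⊗ K.obj) ⊗≫ 𝟙 _ := by
      rw [← whisker_exchange, ← whisker_exchange, BraidedCategory.braiding_tensor_right_hom]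
      monoidal
    _ = 𝟙 _ ⊗≫ K.coaction V ▷ U ⊗≫ V ◁ K.obj ◁ K.coaction U ⊗≫
        (K.coaction V ▷ (K.obj ⊗ U) ≫ (V ⊗ K.obj) ◁ (β_ K.obj U).hom) ▷ K.obj ⊗≫
        V ◁ K.obj ◁ K.coaction U ▷ (K.obj ⊗ K.obj) ⊗≫
        V ◁ (β_ K.obj U).hom ▷ (K.obj ⊗ K.obj ⊗ K.obj) ⊗≫ 𝟙 _ := by
      rw [BraidedCategory.braiding_naturality_right]
      monoidal
    _ = _ := by
      rw [← whisker_exchange, coactionPair]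
      monoidal

/-- Compares coassociativity of `δ` on `V ⊗ U` with that of the paired coaction; `mul` carries one
to the other. -/
lemma mul_comul : K.mul ≫ K.comul =
    (K.comul ⊗ₘ K.comul) ≫ tensorμ K.obj K.obj K.obj K.obj ≫ (K.mul ⊗ₘ K.mul) := by
  apply K.hom_ext_coactionPair'
  intro V U
  calc
    _ = K.coaction (V ⊗ U) ≫ K.coaction (V ⊗ U) ▷ K.obj ≫ (α_ _ _ _).hom := by
      rw [whiskerLeft_comp, reassoc_of% K.coactionPair_mul, coaction_comul]
    _ = K.coactionPair V U ≫ ((V ⊗ U) ◁ K.mul ≫ K.coactionPair V U ▷ K.obj) ≫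
        ((V ⊗ U) ◁ K.mul) ▷ K.obj ≫ (α_ _ _ _).hom := by
      rw [← coactionPair_mul]; simp
    _ = (K.coactionPair V U ≫ K.coactionPair V U ▷ (K.obj ⊗ K.obj) ≫ (α_ _ _ _).hom) ≫
        (V ⊗ U) ◁ (K.mul ⊗ₘ K.mul) := by
      rw [whisker_exchange, tensorHom_def']; monoidal
    _ = _ := by
      rw [coactionPair_comul]; simp

end HandleCoend

end Bialgebra

/-! ### The partial monodromy action and the Yetter–Drinfeld condition -/

section YetterDrinfeldStructure

variable {C : Type u} [Category.{v} C] [MonoidalCategory C] [RigidCategory C]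

namespace HandleCoend

variable [BraidedCategory C] (K : HandleCoend C)

lemma one_action (Y : C) : K.one ▷ Y ≫ K.action Y = (λ_ Y).hom := by
  have h := K.coaction_action (𝟙_ C) Y
  rw [coaction_unit, braiding_tensorUnit_left, braiding_tensorUnit_right] at h
  have h' : K.one ▷ Y ≫ K.action Y = (λ_ (𝟙_ C ⊗ Y)).inv ≫ (α_ _ _ _).inv ≫
      (λ_ _).hom ▷ Y ≫ ((K.one ≫ (λ_ _).inv) ▷ Y ≫ (α_ _ _ _).hom ≫ 𝟙_ C ◁ K.action Y) ≫
        (λ_ _).hom := by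
    monoidal
  rw [h', h]
  monoidal

/-- Both sides correspond to the double braiding of `V ⊗ U` with `Y`. By the hexagons this is the
double braiding of `V` with `Y`, wrapped between `c_{U,Y}` and `c_{Y,U}`. -/
lemma mul_action (Y : C) : K.mul ▷ Y ≫ K.action Y =
    (α_ K.obj K.obj Y).hom ≫ K.obj ◁ K.action Y ≫ K.action Y := by
  apply K.hom_ext_coactionPair
  intro V U
  trans (β_ (V ⊗ U) Y).hom ≫ (β_ Y (V ⊗ U)).hom
  · rw [← K.coaction_action, ← K.coactionPair_mul]
    monoidal
  · symm
    calc
      _ = 𝟙 _ ⊗≫ K.coaction V ▷ (U ⊗ Y) ⊗≫ V ◁ K.obj ◁ K.coaction U ▷ Y ⊗≫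
          V ◁ ((β_ K.obj U).hom ▷ (K.obj ⊗ Y) ≫ (U ⊗ K.obj) ◁ K.action Y) ⊗≫
          V ◁ U ◁ K.action Y ⊗≫ 𝟙 _ := by
        rw [coactionPair]; monoidal
      _ = 𝟙 _ ⊗≫ K.coaction V ▷ (U ⊗ Y) ⊗≫
          V ◁ K.obj ◁ (K.coaction U ▷ Y ≫ (α_ _ _ _).hom ≫ U ◁ K.action Y) ⊗≫
          V ◁ (β_ K.obj U).hom ▷ Y ⊗≫ V ◁ U ◁ K.action Y ⊗≫ 𝟙 _ := by
        rw [← whisker_exchange]; monoidal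
      _ = 𝟙 _ ⊗≫ (K.coaction V ▷ (U ⊗ Y) ≫ (V ⊗ K.obj) ◁ (β_ U Y).hom) ⊗≫
          V ◁ K.obj ◁ (β_ Y U).hom ⊗≫
          V ◁ (β_ K.obj U).hom ▷ Y ⊗≫ V ◁ U ◁ K.action Y ⊗≫ 𝟙 _ := by
        rw [coaction_action]; monoidal
      _ = 𝟙 _ ⊗≫ V ◁ (β_ U Y).hom ⊗≫ K.coaction V ▷ (Y ⊗ U) ⊗≫
          V ◁ ((β_ (K.obj ⊗ Y) U).hom ≫ U ◁ K.action Y) ⊗≫ 𝟙 _ := by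
        rw [← whisker_exchange, BraidedCategory.braiding_tensor_left_hom]; monoidal
      _ = 𝟙 _ ⊗≫ V ◁ (β_ U Y).hom ⊗≫
          (K.coaction V ▷ Y ≫ (α_ _ _ _).hom ≫ V ◁ K.action Y) ▷ U ⊗≫
          V ◁ (β_ Y U).hom ⊗≫ 𝟙 _ := by
        rw [← BraidedCategory.braiding_naturality_left]; monoidal
      _ = _ := by
        rw [coaction_action, BraidedCategory.braiding_tensor_left_hom,
          BraidedCategory.braiding_tensor_right_hom]
        monoidal

lemma action_naturality {X Y : C} (f : X ⟶ Y) :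
    K.action X ≫ f = K.obj ◁ f ≫ K.action Y := by
  apply K.hom_ext_coaction_right
  intro Z
  calc
    _ = (K.coaction Z ▷ X ≫ (α_ _ _ _).hom ≫ Z ◁ K.action X) ≫ Z ◁ f := by simp
    _ = Z ◁ f ≫ K.coaction Z ▷ Y ≫ (α_ _ _ _).hom ≫ Z ◁ K.action Y := by
      rw [coaction_action, coaction_action]; simp
    _ = _ := by rw [whisker_exchange_assoc]; simp

/-- The Yetter–Drinfeld condition for the partial monodromy action and the coaction. -/
lemma yetterDrinfeld_compat (Y : C) :
    (K.comul ⊗ₘ K.coaction Y) ≫ (α_ K.obj K.obj (Y ⊗ K.obj)).hom ≫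
        K.obj ◁ ((α_ K.obj Y K.obj).inv ≫ (β_ K.obj Y).hom ▷ K.obj ≫ (α_ Y K.obj K.obj).hom) ≫
        (α_ K.obj Y (K.obj ⊗ K.obj)).inv ≫ (K.action Y ⊗ₘ K.mul) =
      K.comul ▷ Y ≫ (α_ K.obj K.obj Y).hom ≫ K.obj ◁ K.action Y ≫
        (β_ Y K.obj).inv ≫ K.coaction Y ▷ K.obj ≫ (α_ Y K.obj K.obj).hom ≫ Y ◁ K.mul := by
  apply K.hom_ext_coaction_right
  intro X
  -- The two sides of the condition are the two sides of this naturality square: the left one via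
  -- `coaction_tensor`, the right one via `coaction_tensor_inv`.
  have h := K.coaction_naturality ((β_ X Y).hom ≫ (β_ Y X).hom)
  trans (K.coaction (X ⊗ Y) ≫ ((β_ X Y).hom ≫ (β_ Y X).hom) ▷ K.obj) ≫ (α_ _ _ _).hom
  · calc
      _ = 𝟙 _ ⊗≫ (K.coaction X ≫ X ◁ K.comul) ▷ Y ⊗≫ X ◁ (K.obj ⊗ K.obj) ◁ K.coaction Y ⊗≫
          X ◁ K.obj ◁ (β_ K.obj Y).hom ▷ K.obj ⊗≫ X ◁ K.action Y ▷ (K.obj ⊗ K.obj) ⊗≫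
          (X ⊗ Y) ◁ K.mul ⊗≫ 𝟙 _ := by
        rw [MonoidalCategory.tensorHom_def, MonoidalCategory.tensorHom_def]; monoidal
      _ = 𝟙 _ ⊗≫ K.coaction X ▷ Y ⊗≫ (K.coaction X ▷ (K.obj ⊗ Y) ≫
          (X ⊗ K.obj) ◁ (K.obj ◁ K.coaction Y ≫ (α_ _ _ _).inv ≫ (β_ K.obj Y).hom ▷ K.obj)) ⊗≫
          X ◁ K.action Y ▷ (K.obj ⊗ K.obj) ⊗≫ (X ⊗ Y) ◁ K.mul ⊗≫ 𝟙 _ := by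
        rw [coaction_comul]; monoidal
      _ = 𝟙 _ ⊗≫ K.coactionPair X Y ⊗≫
          (K.coaction X ▷ Y ≫ (α_ _ _ _).hom ≫ X ◁ K.action Y) ▷ (K.obj ⊗ K.obj) ⊗≫
          (X ⊗ Y) ◁ K.mul ⊗≫ 𝟙 _ := by
        rw [← whisker_exchange, coactionPair]; monoidal
      _ = 𝟙 _ ⊗≫ K.coactionPair X Y ⊗≫
          (((β_ X Y).hom ≫ (β_ Y X).hom) ▷ (K.obj ⊗ K.obj) ≫ (X ⊗ Y) ◁ K.mul) ⊗≫ 𝟙 _ := by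
        rw [coaction_action]; monoidal
      _ = _ := by
        rw [← whisker_exchange, ← coactionPair_mul]; monoidal
  · rw [← h]
    symm
    calc
      _ = 𝟙 _ ⊗≫ (K.coaction X ≫ X ◁ K.comul) ▷ Y ⊗≫ X ◁ K.obj ◁ K.action Y ⊗≫
          X ◁ (β_ Y K.obj).inv ⊗≫ X ◁ K.coaction Y ▷ K.obj ⊗≫ (X ⊗ Y) ◁ K.mul ⊗≫ 𝟙 _ := by
        monoidal
      _ = 𝟙 _ ⊗≫ K.coaction X ▷ Y ⊗≫ (K.coaction X ▷ (K.obj ⊗ Y) ≫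
          (X ⊗ K.obj) ◁ K.action Y) ⊗≫
          X ◁ (β_ Y K.obj).inv ⊗≫ X ◁ K.coaction Y ▷ K.obj ⊗≫ (X ⊗ Y) ◁ K.mul ⊗≫ 𝟙 _ := by
        rw [coaction_comul]; monoidal
      _ = 𝟙 _ ⊗≫ (K.coaction X ▷ Y ≫ (α_ _ _ _).hom ≫ X ◁ K.action Y) ⊗≫ K.coaction X ▷ Y ⊗≫
          X ◁ (β_ Y K.obj).inv ⊗≫ X ◁ K.coaction Y ▷ K.obj ⊗≫ (X ⊗ Y) ◁ K.mul ⊗≫ 𝟙 _ := by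
        rw [← whisker_exchange]; monoidal
      _ = _ := by
        rw [coaction_action, coaction_tensor_inv]; monoidal

/-! ### The antipode -/

lemma ι_antipode (X : C) : K.ι X ≫ K.antipode =
    K.coaction (Xᘁ : C) ▷ X ≫ (α_ _ _ _).hom ≫ (Xᘁ : C) ◁ (β_ K.obj X).hom ≫ (α_ _ _ _).inv ≫
      rightEv X ▷ K.obj ≫ (λ_ _).hom := by
  rw [antipode, ι_desc, antipodeFamily, doubleDual, coaction]
  calc
    _ = 𝟙 _ ⊗≫ (𝟙_ C ◁ (β_ (Xᘁ : C) X).hom ≫ rightCoev (Xᘁ : C) ▷ (X ⊗ (Xᘁ : C))) ⊗≫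
        (Xᘁ : C) ◁ (β_ ((Xᘁ)ᘁ : C) X).hom ▷ (Xᘁ : C) ⊗≫
        (rightEv X ▷ (((Xᘁ)ᘁ : C) ⊗ (Xᘁ : C)) ≫ 𝟙_ C ◁ K.ι (Xᘁ : C)) ⊗≫ 𝟙 _ := by
      monoidal
    _ = 𝟙 _ ⊗≫ rightCoev (Xᘁ : C) ▷ ((Xᘁ : C) ⊗ X) ⊗≫
        (Xᘁ : C) ◁ ((β_ (((Xᘁ)ᘁ : C) ⊗ (Xᘁ : C)) X).hom ≫ X ◁ K.ι (Xᘁ : C)) ⊗≫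
        rightEv X ▷ K.obj ⊗≫ 𝟙 _ := by
      rw [whisker_exchange, ← whisker_exchange (rightEv X),
        BraidedCategory.braiding_tensor_left_hom]
      monoidal
    _ = _ := by
      rw [← BraidedCategory.braiding_naturality_left]; monoidal

/-- Naturality of `δ` along the evaluation: the convolution product assembles into the coaction of
`Uᘁ ⊗ U` followed by evaluation, which equals evaluation followed by `one`. -/
lemma antipode_left : K.comul ≫ K.antipode ▷ K.obj ≫ K.mul = K.counit ≫ K.one := by
  apply K.hom_ext
  intro U
  have h := K.coaction_naturality (rightEv U)
  rw [← Category.assoc, ι_comul]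
  calc
    _ = 𝟙 _ ⊗≫ (Uᘁ : C) ◁ K.coaction U ⊗≫ (K.ι U ≫ K.antipode) ▷ K.obj ⊗≫ K.mul := by
      monoidal
    _ = 𝟙 _ ⊗≫ ((Uᘁ : C) ◁ K.coaction U ≫ K.coaction (Uᘁ) ▷ (U ⊗ K.obj)) ⊗≫
        (Uᘁ : C) ◁ (β_ K.obj U).hom ▷ K.obj ⊗≫
        (rightEv U ▷ (K.obj ⊗ K.obj) ≫ 𝟙_ C ◁ K.mul) ⊗≫ 𝟙 _ := by
      rw [ι_antipode]; monoidal
    _ = (K.coactionPair (Uᘁ) U ≫ ((Uᘁ : C) ⊗ U) ◁ K.mul) ≫ rightEv U ▷ K.obj ≫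
        (λ_ _).hom := by
      rw [whisker_exchange, ← whisker_exchange (rightEv U), coactionPair]; monoidal
    _ = rightEv U ≫ K.one := by
      rw [coactionPair_mul, ← reassoc_of% h, coaction_unit]; simp
    _ = _ := by
      rw [← Category.assoc, counit, ι_desc]

lemma antipode_right : K.comul ≫ K.obj ◁ K.antipode ≫ K.mul = K.counit ≫ K.one := by
  apply K.hom_ext_coaction
  intro U
  have h := K.coaction_naturality (rightCoev U)
  have hU := ExactPairing.evaluation_coevaluation U (Uᘁ : C)
  have hev : (β_ K.obj ((Uᘁ : C) ⊗ U)).hom ≫ rightEv U ▷ K.obj =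
      K.obj ◁ rightEv U ≫ (ρ_ _).hom ≫ (λ_ _).inv := by
    rw [← BraidedCategory.braiding_naturality_right, braiding_tensorUnit_right]
  have hone : K.one ▷ U ≫ (β_ K.obj U).hom = (λ_ U).hom ≫ (ρ_ U).inv ≫ U ◁ K.one := by
    rw [BraidedCategory.braiding_naturality_left, braiding_tensorUnit_left]; simp
  -- The intermediate term creates `U ⊗ Uᘁ`, coacts on it, and closes the zigzag after moving `K`
  -- past `U`. Naturality of `δ` along the coevaluation then leaves only the unit of `K`.
  trans 𝟙 _ ⊗≫ (rightCoev U ≫ K.coaction (U ⊗ (Uᘁ : C))) ▷ U ⊗≫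
    (U ⊗ (Uᘁ : C)) ◁ (β_ K.obj U).hom ⊗≫ U ◁ rightEv U ▷ K.obj ⊗≫ 𝟙 _
  · symm
    calc
      _ = 𝟙 _ ⊗≫ rightCoev U ▷ U ⊗≫ K.coactionPair U (Uᘁ) ▷ U ⊗≫
          (U ⊗ (Uᘁ : C)) ◁ (K.mul ▷ U ≫ (β_ K.obj U).hom) ⊗≫ U ◁ rightEv U ▷ K.obj ⊗≫ 𝟙 _ := by
        rw [← coactionPair_mul]; monoidal
      _ = 𝟙 _ ⊗≫ rightCoev U ▷ U ⊗≫ K.coactionPair U (Uᘁ) ▷ U ⊗≫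
          (U ⊗ (Uᘁ : C)) ◁ (β_ (K.obj ⊗ K.obj) U).hom ⊗≫
          U ◁ (((Uᘁ : C) ⊗ U) ◁ K.mul ≫ rightEv U ▷ K.obj) ⊗≫ 𝟙 _ := by
        rw [BraidedCategory.braiding_naturality_left]; monoidal
      _ = 𝟙 _ ⊗≫ rightCoev U ▷ U ⊗≫ K.coaction U ▷ ((Uᘁ : C) ⊗ U) ⊗≫
          U ◁ K.obj ◁ K.coaction (Uᘁ) ▷ U ⊗≫
          U ◁ ((β_ K.obj (Uᘁ)).hom ▷ (K.obj ⊗ U) ≫ ((Uᘁ : C) ⊗ K.obj) ◁ (β_ K.obj U).hom) ⊗≫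
          U ◁ (Uᘁ : C) ◁ (β_ K.obj U).hom ▷ K.obj ⊗≫
          U ◁ rightEv U ▷ (K.obj ⊗ K.obj) ⊗≫ U ◁ K.mul ⊗≫ 𝟙 _ := by
        rw [whisker_exchange, coactionPair, BraidedCategory.braiding_tensor_left_hom]; monoidal
      _ = 𝟙 _ ⊗≫ rightCoev U ▷ U ⊗≫ K.coaction U ▷ ((Uᘁ : C) ⊗ U) ⊗≫
          U ◁ K.obj ◁ K.coaction (Uᘁ) ▷ U ⊗≫ U ◁ K.obj ◁ (Uᘁ : C) ◁ (β_ K.obj U).hom ⊗≫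
          U ◁ ((β_ K.obj ((Uᘁ : C) ⊗ U)).hom ≫ rightEv U ▷ K.obj) ▷ K.obj ⊗≫
          U ◁ K.mul ⊗≫ 𝟙 _ := by
        rw [← whisker_exchange, BraidedCategory.braiding_tensor_right_hom]; monoidal
      _ = 𝟙 _ ⊗≫ rightCoev U ▷ U ⊗≫ (K.coaction U ▷ ((Uᘁ : C) ⊗ U) ≫
          (U ⊗ K.obj) ◁ (K.ι U ≫ K.antipode)) ⊗≫ U ◁ K.mul ⊗≫ 𝟙 _ := by
        rw [hev, ι_antipode]; monoidal
      _ = (K.coaction U ≫ U ◁ K.antipode) ⊗≫ K.coaction U ▷ K.obj ⊗≫ U ◁ K.mul := by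
        rw [← whisker_exchange, coaction_whiskerLeft]; monoidal
      _ = K.coaction U ≫ (K.coaction U ▷ K.obj ≫ (U ⊗ K.obj) ◁ K.antipode) ⊗≫
          U ◁ K.mul := by
        rw [← whisker_exchange]; monoidal
      _ = _ := by
        rw [whiskerLeft_comp, reassoc_of% K.coaction_comul]; monoidal
  · rw [h, coaction_unit]
    calc
      _ = 𝟙 _ ⊗≫ K.one ▷ U ⊗≫
          (rightCoev U ▷ (K.obj ⊗ U) ≫ (U ⊗ (Uᘁ : C)) ◁ (β_ K.obj U).hom) ⊗≫
          U ◁ rightEv U ▷ K.obj ⊗≫ 𝟙 _ := by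
        monoidal
      _ = 𝟙 _ ⊗≫ (K.one ▷ U ≫ (β_ K.obj U).hom) ⊗≫
          (rightCoev U ▷ U ≫ (α_ _ _ _).hom ≫ U ◁ rightEv U) ▷ K.obj ⊗≫ 𝟙 _ := by
        rw [← whisker_exchange]; monoidal
      _ = (ρ_ U).inv ≫ U ◁ K.one := by
        rw [hone, rightCoev, rightEv, hU]; monoidal
      _ = _ := by
        rw [whiskerLeft_comp, reassoc_of% K.coaction_counit]

/-! ### Assembly of the structures and the embedding -/

/-- The handle Hopf algebra. -/
@[reducible]
noncomputable def hopfObj : HopfObj K.obj where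
  one := K.one
  mul := K.mul
  one_mul := K.one_mul
  mul_one := K.mul_one
  mul_assoc := K.mul_assoc
  counit := K.counit
  comul := K.comul
  counit_comul := K.counit_comul
  comul_counit := K.comul_counit
  comul_assoc := K.comul_assoc
  mul_comul := K.mul_comul
  one_comul := K.one_comul
  mul_counit := K.mul_counit
  one_counit := K.one_counit
  antipode := K.antipode
  antipode_left := K.antipode_left
  antipode_right := K.antipode_right

/-- The Yetter–Drinfeld structure given by the partial monodromy action and the coaction. -/
@[reducible]
noncomputable def yetterDrinfeldObj (Y : C) :
    letI := K.hopfObj; YetterDrinfeldObj K.obj Y :=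
  letI := K.hopfObj
  { smul := K.action Y
    one_smul := K.one_action Y
    mul_smul := K.mul_action Y
    coact := K.coaction Y
    coact_counit := K.coaction_counit Y
    coact_comul := K.coaction_comul Y
    compat := K.yetterDrinfeld_compat Y }

/-- The embedding of the category into the Yetter–Drinfeld modules over the coend. -/
noncomputable def yetterDrinfeldEmbedding :
    letI := K.hopfObj; C ⥤ YetterDrinfeldModule K.obj :=
  letI := K.hopfObj
  { obj Y := ⟨Y, K.yetterDrinfeldObj Y⟩
    map f := ⟨f, K.action_naturality f, K.coaction_naturality f⟩ }

end HandleCoend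

end YetterDrinfeldStructure

theorem proposition3 (k : Type w) [Field k] (C : Type u) [Category.{v} C] [Abelian C] [Linear k C]
    [MonoidalCategory C] [MonoidalPreadditive C] [MonoidalLinear k C] [RigidCategory C]
    [BraidedCategory C] [RibbonCategory C] [IsFiniteTensorCategory k C] :
    -- the coend `K = ∫^X Xᘁ ⊗ X` exists, and for every such coend:
    Nonempty (HandleCoend C) ∧ ∀ K : HandleCoend C,
      -- `K` is a Hopf algebra in `C` with the structural morphisms of the handle Hopf algebra,
      ∃ H : HopfObj K.obj,
        (MonObj.mul (X := K.obj) = K.mul ∧ MonObj.one (X := K.obj) = K.one ∧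
          ComonObj.comul (X := K.obj) = K.comul ∧ ComonObj.counit (X := K.obj) = K.counit ∧
          HopfObj.antipode (X := K.obj) = K.antipode) ∧
        -- the partial monodromy action makes every object a left `K`-module,
        (∀ Y : C, ∃ M : ModObj K.obj Y, (M.smul : K.obj ⊗ Y ⟶ Y) = K.action Y) ∧
        -- action and coaction make every object a left-right Yetter–Drinfeld module,
        ∃ yd : ∀ Y : C, YetterDrinfeldObj K.obj Y,
          (∀ Y : C, ((yd Y).smul : K.obj ⊗ Y ⟶ Y) = K.action Y ∧ (yd Y).coact = K.coaction Y) ∧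
          -- and this is the object part of a fully faithful embedding `f ↦ f`.
          ∃ F : C ⥤ YetterDrinfeldModule K.obj,
            (∀ Y : C, F.obj Y = ⟨Y, yd Y⟩) ∧
            F ⋙ YetterDrinfeldModule.forget K.obj = 𝟭 C ∧ F.Full ∧ F.Faithful := by
  refine ⟨HandleCoend.nonempty k, fun K => ?_⟩
  let _ := K.hopfObj
  refine ⟨K.hopfObj, ⟨rfl, rfl, rfl, rfl, rfl⟩,
    fun Y => ⟨(K.yetterDrinfeldObj Y).toModObj, rfl⟩, K.yetterDrinfeldObj,
    fun Y => ⟨rfl, rfl⟩, K.yetterDrinfeldEmbedding, fun Y => rfl, rfl, ⟨?_⟩, ⟨?_⟩⟩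
  -- The underlying morphism is a preimage, since linearity and colinearity hold for every morphism
  -- of `C`.
  · exact fun f => ⟨f.hom, rfl⟩
  · exact fun h => congrArg YetterDrinfeldModule.Hom.hom h
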